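/- Let $k>0$ be real. For $a,c\in\mathbb{R}$ with $c>0$ put ${}_1F_1(a,c;z)=\sum_{m\ge0}\frac{(a)_m}{(c)_m}\frac{z^m}{m!}$, and let $C_j^{(k)}(z)=\frac{(2k)_j}{j!}\,{}_2F_1\big(-j,j+2k;k+\tfrac12;\tfrac{1-z}{2}\big)$ be the Gegenbauer polynomials, where $(a)_m=a(a+1)\cdots(a+m-1)$. Let $\Sigma_p=\{(u_1,\dots,u_p): u_s\ge0,\ u_1+\cdots+u_p=1\}$, and let integrals over $\Sigma_p$ be taken with respect to Lebesgue measure $du_1\cdots du_{p-1}$ in the first $p-1$ coordinates. Then for every integer $p\ge2$ and all $v,\phi\in\mathbb{R}$ the series below converges absolutely, the integrand on the right is integrable over $\Sigma_p$, and $$\sum_{j\ge0}\frac{\Gamma(p(j+1))}{\Gamma(2p(j+k))}\,v^{pj}\,{}_1F_1\big(p(j+1),2p(j+k)+1;v\big)\,C_j^{(k)}(\cos 2p\phi) =\frac{\Gamma(p)\Gamma(pk)}{\Gamma(k)^p\,\Gamma(2pk)}\int_{\Sigma_p}\prod_{s=1}^p u_s^{k-1}\;{}_1F_1\Big(p,pk+\tfrac12;\,v\sum_{s=1}^p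 u_s\cos^2\big(\phi+\tfrac{s\pi}{p}\big)\Big)\,du_1\cdots du_{p-1}.$$ This extends the following formula for $p=2$, which also holds, with an integrable integrand, for all $v,\phi\in\mathbb{R}$: $$\sum_{j\ge0}\frac{\Gamma(2(j+1))}{\Gamma(4(j+k))}\,v^{2j}\,{}_1F_1\big(2(j+1),4(j+k)+1;v\big)\,C_j^{(k)}(\cos4\phi) =\frac{1}{\Gamma(4k)}\int{}_1F_1\Big(2,2k+\tfrac12;\,\frac{v(1-u\cos2\phi)}{2}\Big)\mu^k(du),$$ where $\mu^k(du)=\frac{\Gamma(k+1/2)}{\sqrt\pi\,\Gamma(k)}(1-u^2)^{k-1}\mathbf{1}_{[-1,1]}(u)\,du$. -/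

import Mathlib

open MeasureTheory

/-- Kummer's confluent hypergeometric series
`₁F₁(a, c, z) = ∑ₘ (a)ₘ / (c)ₘ * zᵐ / m!`, where `(a)ₘ = a (a + 1) ⋯ (a + m - 1)`. -/
noncomputable def confluentHypergeometric (a c z : ℝ) : ℝ :=
  ∑' m : ℕ, (ascPochhammer ℝ m).eval a / (ascPochhammer ℝ m).eval c *
    (z ^ m / (m.factorial : ℝ))

/-- The Gegenbauer polynomial
`C_j^(l)(z) = (2l)ⱼ / j! * ₂F₁(-j, j + 2l; l + 1/2; (1 - z)/2)` (for `l ≠ 0`); the Gauss series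
terminates. -/
noncomputable def gegenbauerC (l : ℝ) (j : ℕ) (z : ℝ) : ℝ :=
  (ascPochhammer ℝ j).eval (2 * l) / (j.factorial : ℝ) *
    ordinaryHypergeometric (-(j : ℝ)) ((j : ℝ) + 2 * l) (l + 1 / 2) ((1 - z) / 2)

/-- The point `(u₁, …, u_{p-1}, 1 - u₁ - ⋯ - u_{p-1})` of the hyperplane `∑ u_s = 1` in `ℝᵖ` with
first coordinates `(u₁, …, u_{p-1})`. The coordinate `u_s`, `1 ≤ s ≤ p`, has index `s - 1` in
`Fin p`. -/
noncomputable def simplexPoint (p : ℕ) (x : Fin (p - 1) → ℝ) : Fin p → ℝ :=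
  fun s => if h : (s : ℕ) < p - 1 then x ⟨s, h⟩ else 1 - ∑ i, x i

/-- The standard simplex `Σ_p`, parametrized by the first `p - 1` coordinates. Integration over
`Σ_p` against `du₁ ⋯ du_{p-1}` is Lebesgue integration over this set. -/
def simplexDomain (p : ℕ) : Set (Fin (p - 1) → ℝ) :=
  {x | simplexPoint p x ∈ stdSimplex ℝ (Fin p)}

/-- The general term of the series
`∑ⱼ Γ(p(j+1)) / Γ(2p(j+k)) v^{pj} ₁F₁(p(j+1), 2p(j+k)+1, v) C_j^(k)(cos 2pφ)`. -/
noncomputable def seriesTerm (p : ℕ) (k v φ : ℝ) (j : ℕ) : ℝ :=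
  Real.Gamma (p * (j + 1)) / Real.Gamma (2 * p * (j + k)) * v ^ (p * j) *
    confluentHypergeometric (p * (j + 1)) (2 * p * (j + k) + 1) v *
    gegenbauerC k j (Real.cos (2 * p * φ))

/-- The integrand
`∏ₛ u_s^{k-1} ₁F₁(p, pk + 1/2; v ∑ₛ u_s cos²(φ + sπ/p))`, `s = 1, …, p`; the index `s : Fin p`
stands for the number `s + 1`. -/
noncomputable def simplexIntegrand (p : ℕ) (k v φ : ℝ) (u : Fin p → ℝ) : ℝ :=
  (∏ s, u s ^ (k - 1)) *
    confluentHypergeometric p (p * k + 1 / 2)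
      (v * ∑ s : Fin p, u s * Real.cos (φ + ((s : ℕ) + 1 : ℝ) * Real.pi / p) ^ 2)

/-- The symmetric Beta distribution
`Γ(s + 1/2) / (√π Γ(s)) (1 - u²)^{s-1} 1_{[-1,1]}(u) du`, `s > 0`. -/
noncomputable def symmetricBeta (s : ℝ) : Measure ℝ :=
  (volume.restrict (Set.Icc (-1 : ℝ) 1)).withDensity fun u =>
    ENNReal.ofReal (Real.Gamma (s + 1 / 2) / (Real.sqrt Real.pi * Real.Gamma s) *
      (1 - u ^ 2) ^ (s - 1))

/-! Both sides are expanded in powers of v and their coefficients compared.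

On the right, put y_s = 4 cos²(φ + sπ/p). The multinomial theorem and Dirichlet's integral turn the
n-th moment of ∑ u_s y_s into the coefficient of Xⁿ in ∏ (1 - y_s X)^(-k) (`dirichlet_moment`). To
compute that coefficient, substitute X = t/(1+t)². Each factor 1 - y_s X becomes (1 - 2cos(2φ +
2sπ/p) t + t²)/(1+t)², and the product over s collapses by roots of unity to (1 - 2cos(2pφ) t^p +
t^(2p))/(1+t)^(2p). Its power -k is (1+t)^(2pk) times the Gegenbauer generating function in t^p
(`prod_negPowSeries_subst`). Lagrange inversion then returns to the coefficient in X
(`coeff_prod_negPowSeries`).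

On the left, expanding ₁F₁ gives an absolutely convergent double series in v^(pj+m); grouping by n =
pj + m produces the same coefficients (`exists_hasSum_seriesTerm`).

Powers with real exponent are handled formally: V^(-k) is the unique series with constant term 1
satisfying V U' + k V' U = 0. Every power identity is therefore proved by checking that both sides
solve one equation. The formula with μ^k is the case p = 2 after an affine change of variable. -/

/-- The binomial series `(1 - x X)^(-r)` as a formal power series. -/
noncomputable def negPowSeries (r x : ℝ) : PowerSeries ℝ :=
  PowerSeries.mk fun n => (ascPochhammer ℝ n).eval r / (n.factorial : ℝ) * x ^ n

/-- `U` is the formal power `V ^ (-k)`, expressed through the logarithmic derivative. -/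
structure IsNegPow (V : PowerSeries ℝ) (k : ℝ) (U : PowerSeries ℝ) : Prop where
  constantCoeff_base : PowerSeries.constantCoeff V = 1
  constantCoeff_power : PowerSeries.constantCoeff U = 1
  derivative_eq : V * PowerSeries.derivative ℝ U +
    PowerSeries.C k * PowerSeries.derivative ℝ V * U = 0

/-! ### Real powers of formal power series -/

section FormalPowers

open PowerSeries

namespace IsNegPow

theorem mul {V W U T : PowerSeries ℝ} {k : ℝ} (h₁ : IsNegPow V k U) (h₂ : IsNegPow W k T) :
    IsNegPow (V * W) k (U * T) where
  constantCoeff_base := by simp [h₁.1, h₂.1]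
  constantCoeff_power := by simp [h₁.2, h₂.2]
  derivative_eq := by
    simp only [Derivation.leibniz, smul_eq_mul]
    linear_combination W * T * h₁.3 + V * U * h₂.3

theorem add_exponent {V U T : PowerSeries ℝ} {k l : ℝ} (h₁ : IsNegPow V k U)
    (h₂ : IsNegPow V l T) : IsNegPow V (k + l) (U * T) where
  constantCoeff_base := h₁.1
  constantCoeff_power := by simp [h₁.2, h₂.2]
  derivative_eq := by
    simp only [Derivation.leibniz, smul_eq_mul, map_add]
    linear_combination T * h₁.3 + U * h₂.3

theorem one (k : ℝ) : IsNegPow 1 k 1 where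
  constantCoeff_base := by simp
  constantCoeff_power := by simp
  derivative_eq := by simp

theorem prod {ι : Type*} {s : Finset ι} {V U : ι → PowerSeries ℝ} {k : ℝ}
    (h : ∀ i ∈ s, IsNegPow (V i) k (U i)) : IsNegPow (∏ i ∈ s, V i) k (∏ i ∈ s, U i) := by
  classical
  induction s using Finset.induction_on with
  | empty => simpa using one k
  | insert a s ha ih =>
    rw [Finset.prod_insert ha, Finset.prod_insert ha]
    exact (h a (by simp)).mul (ih fun i hi => h i (by simp [hi]))

theorem subst {V U g : PowerSeries ℝ} {k : ℝ} (h : IsNegPow V k U) (hg : constantCoeff g = 0) :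
    IsNegPow (V.subst g) k (U.subst g) := by
  have hs : HasSubst g := HasSubst.of_constantCoeff_zero' hg
  have hone : ∀ W : PowerSeries ℝ, constantCoeff W = 1 → constantCoeff (W.subst g) = 1 := by
    intro W hW
    have h0 : constantCoeff ((W - 1).subst g) = 0 :=
      constantCoeff_subst_eq_zero (a := g) hg (W - 1) (by simp [hW])
    have h1 : (1 : PowerSeries ℝ).subst g = 1 := by
      rw [← coe_substAlgHom hs, map_one]
    rw [subst_sub hs, h1, map_sub, map_one] at h0
    linarith
  refine ⟨hone V h.1, hone U h.2, ?_⟩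
  have h3 := congrArg (substAlgHom hs) h.3
  simp only [map_add, map_mul, map_zero] at h3
  simp only [coe_substAlgHom hs] at h3
  have hC : (C k : PowerSeries ℝ).subst g = C k := subst_C k
  rw [hC] at h3
  rw [derivative_subst hs, derivative_subst hs]
  linear_combination (derivative ℝ g) * h3

/-- Since V has constant term 1, the coefficient of Xⁿ in the equation determines (n+1) times the
next coefficient of U from the earlier ones. -/
theorem unique {V U T : PowerSeries ℝ} {k : ℝ} (h₁ : IsNegPow V k U) (h₂ : IsNegPow V k T) :
    U = T := by
  ext n
  induction n using Nat.strong_induction_on with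
  | _ n ih =>
    rcases n with _ | n
    · simp [h₁.2, h₂.2]
    have key : V * derivative ℝ (U - T) = - (C k * derivative ℝ V * (U - T)) := by
      rw [map_sub]
      linear_combination h₁.3 - h₂.3
    have hc := congrArg (coeff n) key
    have hl : coeff n (V * derivative ℝ (U - T)) = coeff (n + 1) (U - T) * (n + 1) := by
      rw [coeff_mul, Finset.sum_eq_single (0, n)]
      · simp [coeff_derivative, h₁.1]
        ring
      · rintro ⟨a, b⟩ hab hne
        have hab' : a + b = n := by simpa using hab
        have hb : b + 1 < n + 1 := by
          rcases a with _ | a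
          · exact absurd (by simp [← hab']) hne
          · omega
        simp [coeff_derivative, ih (b + 1) hb]
      · simp
    have hr : coeff n (C k * derivative ℝ V * (U - T)) = 0 := by
      rw [coeff_mul]
      refine Finset.sum_eq_zero ?_
      rintro ⟨a, b⟩ hab
      have hab' : a + b = n := by simpa using hab
      simp [ih b (by omega)]
    rw [hl, map_neg, hr, neg_zero] at hc
    have hn : (n + 1 : ℝ) ≠ 0 := by positivity
    have := (mul_eq_zero.mp hc).resolve_right hn
    rw [map_sub] at this
    linarith

end IsNegPow

theorem isNegPow_negPowSeries (r x : ℝ) : IsNegPow (1 - C x * X) r (negPowSeries r x) where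
  constantCoeff_base := by simp
  constantCoeff_power := by simp [negPowSeries, ← coeff_zero_eq_constantCoeff_apply]
  derivative_eq := by
    have hd : derivative ℝ (1 - C x * X) = - C x := by simp
    rw [hd]
    ext n
    have e : (1 - C x * X) * derivative ℝ (negPowSeries r x) + C r * -C x * negPowSeries r x
        = derivative ℝ (negPowSeries r x) - C x * (X * derivative ℝ (negPowSeries r x))
          - C (r * x) * negPowSeries r x := by
      rw [map_mul]; ring
    rw [e]
    rcases n with _ | n
    · rw [map_sub, map_sub, coeff_C_mul, coeff_C_mul, coeff_zero_X_mul, coeff_derivative]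
      simp [negPowSeries]
    · simp only [map_sub, coeff_C_mul, coeff_succ_X_mul, coeff_derivative, negPowSeries, coeff_mk,
        ascPochhammer_succ_eval, Nat.factorial_succ, pow_succ, map_zero]
      push_cast
      have h1 : (n.factorial : ℝ) ≠ 0 := by positivity
      field_simp
      ring

theorem negPowSeries_mul (r s x : ℝ) :
    negPowSeries r x * negPowSeries s x = negPowSeries (r + s) x :=
  ((isNegPow_negPowSeries r x).add_exponent (isNegPow_negPowSeries s x)).unique
    (isNegPow_negPowSeries (r + s) x)

theorem negPowSeries_zero (x : ℝ) : negPowSeries 0 x = 1 :=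
  (isNegPow_negPowSeries 0 x).unique
    ⟨by simp, by simp, by simp⟩

theorem negPowSeries_pow (r x : ℝ) (n : ℕ) :
    negPowSeries r x ^ n = negPowSeries (n * r) x := by
  induction n with
  | zero => simp [negPowSeries_zero]
  | succ n ih =>
    rw [pow_succ, ih, negPowSeries_mul]
    push_cast
    ring_nf

theorem negPowSeries_neg_one (x : ℝ) : negPowSeries (-1) x = 1 - C x * X := by
  refine (isNegPow_negPowSeries (-1) x).unique ⟨by simp, by simp, ?_⟩
  simp
  ring

/-- Both binomial series satisfy first-order equations with leading coefficient 1 - xX; combining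
them gives the required equation times 1 - xX, which cancels because power series over ℝ form a
domain. -/
theorem isNegPow_negPowSeries_power (a x k : ℝ) :
    IsNegPow (negPowSeries a x) k (negPowSeries (-(a * k)) x) := by
  have h₁ := isNegPow_negPowSeries a x
  have h₂ := isNegPow_negPowSeries (-(a * k)) x
  refine ⟨h₁.2, h₂.2, ?_⟩
  have hne : (1 - C x * X : PowerSeries ℝ) ≠ 0 := by
    intro h
    have := congrArg constantCoeff h
    simp at this
  have h3 := h₁.3
  have h4 := h₂.3
  simp only [map_neg, map_mul] at h3 h4
  refine (mul_eq_zero.mp ?_).resolve_left hne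
  linear_combination (negPowSeries a x) * h4 + C k * negPowSeries (-(a * k)) x * h3

/-- Coefficients of a composition with a series divisible by `X`, multiplied by a series. -/
theorem coeff_subst_X_mul_mul (A h H : PowerSeries ℝ) (n : ℕ) :
    coeff n (A.subst (X * h) * H) =
      ∑ m ∈ Finset.range (n + 1), coeff m A * coeff (n - m) (h ^ m * H) := by
  have hs : HasSubst (X * h : PowerSeries ℝ) := HasSubst.of_constantCoeff_zero' (by simp)
  -- After substitution the tail is divisible by X^(n+1), so only the polynomial part reaches the
  -- coefficient of Xⁿ.
  have hA : A = (trunc (n + 1) A : PowerSeries ℝ) +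
      X ^ (n + 1) * (PowerSeries.mk fun i => coeff (i + (n + 1)) A) := by
    ext d
    simp only [map_add, Polynomial.coeff_coe, coeff_trunc, coeff_X_pow_mul', coeff_mk]
    by_cases hd : d < n + 1
    · simp [hd, show ¬ n + 1 ≤ d by omega]
    · have hd' : n + 1 ≤ d := by omega
      simp [hd, hd']
  conv_lhs => rw [hA]
  rw [subst_add hs, subst_mul hs, add_mul, map_add]
  have hX : (X ^ (n + 1) : PowerSeries ℝ).subst (X * h) = X ^ (n + 1) * h ^ (n + 1) := by
    have hX1 : (X : PowerSeries ℝ).subst (X * h) = X * h := subst_X hs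
    rw [subst_pow hs, hX1, mul_pow]
  rw [hX, mul_assoc, mul_assoc, coeff_X_pow_mul', if_neg (by omega), add_zero]
  rw [subst_coe hs, Polynomial.aeval_eq_sum_range' (n := n + 1)
    (natDegree_trunc_lt A n), Finset.sum_mul, map_sum]
  refine Finset.sum_congr rfl fun m hm => ?_
  have hm' : m < n + 1 := Finset.mem_range.mp hm
  rw [smul_mul_assoc, coeff_smul, mul_pow, mul_assoc, coeff_X_pow_mul', if_pos (by omega),
    coeff_trunc, if_pos hm', smul_eq_mul]

end FormalPowers

/-! ### Gegenbauer generating function and the product over roots of unity -/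

section GegenbauerSeries

open PowerSeries

/-- The generating function of the Gegenbauer polynomials at `z`. -/
noncomputable def gegenbauerSeries (k z : ℝ) : PowerSeries ℝ :=
  PowerSeries.mk fun j => gegenbauerC k j z

theorem ascPochhammer_eval_add (m n : ℕ) (x : ℝ) :
    (ascPochhammer ℝ (m + n)).eval x =
      (ascPochhammer ℝ m).eval x * (ascPochhammer ℝ n).eval (x + m) := by
  rw [← ascPochhammer_mul]
  simp [Polynomial.eval_comp]

theorem ascPochhammer_eval_two_mul (m : ℕ) (x : ℝ) :
    (ascPochhammer ℝ (2 * m)).eval (2 * x) =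
      4 ^ m * (ascPochhammer ℝ m).eval x * (ascPochhammer ℝ m).eval (x + 1 / 2) := by
  induction m with
  | zero => simp
  | succ m ih =>
    rw [show 2 * (m + 1) = 2 * m + 1 + 1 by ring]
    simp only [ascPochhammer_succ_eval, ih, pow_succ]
    push_cast
    ring

theorem ascPochhammer_eval_neg_natCast (m j : ℕ) (h : m ≤ j) :
    (ascPochhammer ℝ m).eval (-(j : ℝ)) = (-1) ^ m * (j.factorial / (j - m).factorial) := by
  rw [ascPochhammer_eval_neg_eq_descPochhammer]
  congr 1
  rw [descPochhammer_eval_eq_descFactorial, eq_div_iff (by positivity), mul_comm]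
  exact_mod_cast Nat.factorial_mul_descFactorial h

/-- Splitting (2k)_{j+m} as (2k)_j (2k+j)_m and as (2k)_{2m} (2k+2m)_{j-m}, then using duplication
for (2k)_{2m}, cancels (k+1/2)_m. The result has the shape of a coefficient of a composition. -/
theorem gegenbauerC_eq_sum {k : ℝ} (hk : 0 < k) (j : ℕ) (y : ℝ) :
    gegenbauerC k j y = ∑ m ∈ Finset.range (j + 1),
      (ascPochhammer ℝ m).eval k / (m.factorial : ℝ) * (-4 * ((1 - y) / 2)) ^ m *
        ((ascPochhammer ℝ (j - m)).eval (2 * k + 2 * m) / ((j - m).factorial : ℝ)) := by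
  rw [gegenbauerC, ordinaryHypergeometric_eq_tsum]
  dsimp only
  rw [tsum_eq_sum (s := Finset.range (j + 1)), Finset.mul_sum]
  · refine Finset.sum_congr rfl fun m hm => ?_
    have hm' : m ≤ j := by simpa [Nat.lt_succ_iff] using hm
    have h1 : (ascPochhammer ℝ (j + m)).eval (2 * k) =
        (ascPochhammer ℝ j).eval (2 * k) * (ascPochhammer ℝ m).eval ((j : ℝ) + 2 * k) := by
      rw [ascPochhammer_eval_add, add_comm (2 * k)]
    have h2 : (ascPochhammer ℝ (j + m)).eval (2 * k) =
        4 ^ m * (ascPochhammer ℝ m).eval k * (ascPochhammer ℝ m).eval (k + 1 / 2) *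
          (ascPochhammer ℝ (j - m)).eval (2 * k + 2 * m) := by
      rw [show j + m = 2 * m + (j - m) by omega, ascPochhammer_eval_add,
        ascPochhammer_eval_two_mul]
      push_cast
      rfl
    have h3 : (ascPochhammer ℝ m).eval (k + 1 / 2) ≠ 0 :=
      (ascPochhammer_pos m _ (by positivity)).ne'
    rw [ascPochhammer_eval_neg_natCast m j hm', smul_eq_mul, mul_pow,
      show (-4 : ℝ) ^ m = (-1) ^ m * 4 ^ m by rw [← mul_pow]; norm_num]
    rw [h1] at h2
    have h4 : (j.factorial : ℝ) ≠ 0 := by positivity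
    have h5 : (m.factorial : ℝ) ≠ 0 := by positivity
    have h6 : ((j - m).factorial : ℝ) ≠ 0 := by positivity
    generalize (ascPochhammer ℝ m).eval (k + 1 / 2) = c at *
    generalize (ascPochhammer ℝ (j - m)).eval (2 * k + 2 * (m : ℝ)) = d at *
    generalize ((1 - y) / 2) ^ m = w
    field_simp
    linear_combination w * h2
  · intro m hm
    have hm' : j < m := by simpa [Nat.lt_succ_iff] using hm
    rw [ascPochhammer_eval_neg_coe_nat_of_lt hm']
    simp

theorem gegenbauerSeries_eq {k : ℝ} (hk : 0 < k) (y : ℝ) :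
    gegenbauerSeries k y =
      (negPowSeries k (-4 * ((1 - y) / 2))).subst (X * negPowSeries 2 1) *
        negPowSeries (2 * k) 1 := by
  ext j
  rw [coeff_subst_X_mul_mul, gegenbauerSeries, coeff_mk, gegenbauerC_eq_sum hk]
  refine Finset.sum_congr rfl fun m _ => ?_
  rw [negPowSeries_pow, negPowSeries_mul]
  simp only [negPowSeries, coeff_mk, one_pow, mul_one]
  ring_nf

/-- The underlying identity is (1-t)² (1 + 2(1-y) t/(1-t)²) = 1 - 2yt + t². -/
theorem isNegPow_gegenbauerSeries {k : ℝ} (hk : 0 < k) (y : ℝ) :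
    IsNegPow (1 - C (2 * y) * X + X ^ 2) k (gegenbauerSeries k y) := by
  rw [gegenbauerSeries_eq hk]
  have h₁ := (isNegPow_negPowSeries k (-4 * ((1 - y) / 2))).subst
    (g := X * negPowSeries 2 1) (by simp)
  have h₂ := isNegPow_negPowSeries_power (-2) 1 k
  rw [show -(-2 * k) = 2 * k by ring] at h₂
  convert h₁.mul h₂ using 1
  have hs : HasSubst (X * negPowSeries 2 1 : PowerSeries ℝ) :=
    HasSubst.of_constantCoeff_zero' (by simp)
  have hone : (1 : PowerSeries ℝ).subst (X * negPowSeries 2 1) = (1 : PowerSeries ℝ) := by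
    rw [← coe_substAlgHom hs, map_one]
  have hC : ∀ r : ℝ, (C r : PowerSeries ℝ).subst (X * negPowSeries 2 1) = C r :=
    fun r => subst_C r
  have hX : (X : PowerSeries ℝ).subst (X * negPowSeries 2 1) = X * negPowSeries 2 1 := subst_X hs
  rw [subst_sub hs, subst_mul hs, hone, hC, hX]
  have h2 : negPowSeries 2 1 * negPowSeries (-2) 1 = 1 := by
    rw [negPowSeries_mul]; norm_num [negPowSeries_zero]
  have h3 : negPowSeries (-2) 1 = (1 - X) ^ 2 := by
    have := negPowSeries_pow (-1) 1 2
    rw [negPowSeries_neg_one] at this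
    rw [map_one, one_mul] at this
    rw [this]; norm_num
  have h4 : (C (-4 * ((1 - y) / 2)) : PowerSeries ℝ) = C (2 * y) - 2 := by
    rw [show (2 : PowerSeries ℝ) = C 2 from (map_ofNat C 2).symm, ← map_sub]
    congr 1; ring
  rw [h4]
  linear_combination -h3 + (C (2 * y) - 2) * X * h2

/-- Over ℂ, 1 - 2cos(α)X + X² = (1 - e^{iα}X)(1 - e^{-iα}X), and as α runs over θ + 2sπ/p each
family of linear factors multiplies out to 1 - e^{±ipθ}X^p. -/
theorem prod_one_sub_two_cos_mul_X_add_X_sq {p : ℕ} (hp : 0 < p) (θ : ℝ) :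
    ∏ s : Fin p, (1 - C (2 * Real.cos (θ + 2 * (((s : ℕ) + 1 : ℝ) * Real.pi / p))) * X + X ^ 2) =
      (1 - C (2 * Real.cos (p * θ)) * X ^ p + X ^ (2 * p) : PowerSeries ℝ) := by
  have hinj : Function.Injective (PowerSeries.map (algebraMap ℝ ℂ)) := by
    intro f g hfg
    ext n
    have := congrArg (coeff n) hfg
    simpa using this
  apply hinj
  simp only [map_prod, map_add, map_sub, map_mul, map_one, map_pow, PowerSeries.map_X,
    PowerSeries.map_C]
  have hω := Complex.isPrimitiveRoot_exp p hp.ne'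
  have hCinj : Function.Injective (C : ℂ →+* PowerSeries ℂ) := PowerSeries.C_injective
  have key : ∀ a ω : ℂ, IsPrimitiveRoot ω p →
      ∏ s : Fin p, (1 - C (a * ω ^ ((s : ℕ) + 1)) * X) = (1 - C (a ^ p) * X ^ p : PowerSeries ℂ) := by
    intro a ω hω
    have hζ : IsPrimitiveRoot (C ω : PowerSeries ℂ) p := hω.map_of_injective hCinj
    -- Power series over ℂ serve as the coefficient ring, and the factorization is evaluated at 1.
    -- The extra ω in the p-th root shifts the exponents from 0, …, p-1 to 1, …, p.
    have h := X_pow_sub_C_eq_prod hζ (α := C (a * ω) * X) hp rfl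
    have h' := congrArg (Polynomial.eval 1) h
    simp only [Polynomial.eval_prod, Polynomial.eval_sub, Polynomial.eval_pow, Polynomial.eval_X,
      Polynomial.eval_C, one_pow] at h'
    rw [mul_pow, ← map_pow, mul_pow, hω.pow_eq_one, mul_one] at h'
    rw [h', Finset.prod_range]
    refine Finset.prod_congr rfl fun s _ => ?_
    rw [← map_pow, ← mul_assoc, ← map_mul]
    ring_nf
  have k₁ := key (Complex.exp (θ * Complex.I)) _ hω
  have k₂ := key (Complex.exp (-(θ * Complex.I))) _ hω.inv
  have hfac : ∀ a b : ℂ, a * b = 1 → ∀ n : ℕ,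
      (1 - C a * X ^ n) * (1 - C b * X ^ n) =
        (1 - C (a + b) * X ^ n + X ^ (2 * n) : PowerSeries ℂ) := by
    intro a b hab n
    have h1 : (C a * C b : PowerSeries ℂ) = 1 := by rw [← map_mul, hab, map_one]
    rw [map_add]
    linear_combination (X ^ (2 * n)) * h1
  have hcos : ∀ t : ℝ, (C (algebraMap ℝ ℂ 2) * C (algebraMap ℝ ℂ (Real.cos t)) : PowerSeries ℂ) =
      C (Complex.exp (t * Complex.I) + Complex.exp (-(t * Complex.I))) := by
    intro t
    rw [← map_mul]
    congr 1
    simp [Complex.cos, ← neg_mul]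
    ring
  rw [hcos, ← hfac _ _ (by rw [← Complex.exp_add]; simp)]
  have e₁ : Complex.exp ((p * θ : ℝ) * Complex.I) = Complex.exp (θ * Complex.I) ^ p := by
    rw [← Complex.exp_nat_mul]; push_cast; ring_nf
  have e₂ : Complex.exp (-((p * θ : ℝ) * Complex.I)) = Complex.exp (-(θ * Complex.I)) ^ p := by
    rw [← Complex.exp_nat_mul]; push_cast; ring_nf
  rw [e₁, e₂, ← k₁, ← k₂, ← Finset.prod_mul_distrib]
  refine Finset.prod_congr rfl fun s _ => ?_
  have a₁ : Complex.exp (θ * Complex.I) * Complex.exp (2 * Real.pi * Complex.I / p) ^ ((s : ℕ) + 1)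
      = Complex.exp ((θ + 2 * (((s : ℕ) + 1 : ℝ) * Real.pi / p) : ℝ) * Complex.I) := by
    rw [← Complex.exp_nat_mul, ← Complex.exp_add]; push_cast; ring_nf
  have a₂ : Complex.exp (-(θ * Complex.I)) *
      (Complex.exp (2 * Real.pi * Complex.I / p))⁻¹ ^ ((s : ℕ) + 1)
      = Complex.exp (-((θ + 2 * (((s : ℕ) + 1 : ℝ) * Real.pi / p) : ℝ) * Complex.I)) := by
    rw [← Complex.exp_neg, ← Complex.exp_nat_mul, ← Complex.exp_add]; push_cast; ring_nf
  rw [a₁, a₂, hcos]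
  have := hfac _ _ (by rw [← Complex.exp_add]; simp :
    Complex.exp ((θ + 2 * (((s : ℕ) + 1 : ℝ) * Real.pi / p) : ℝ) * Complex.I) *
    Complex.exp (-((θ + 2 * (((s : ℕ) + 1 : ℝ) * Real.pi / p) : ℝ) * Complex.I)) = 1) 1
  simp only [pow_one, mul_one] at this
  exact this.symm

end GegenbauerSeries

/-! ### Lagrange inversion and the coefficients of the product -/

section LagrangeInversion

open PowerSeries

theorem ascPochhammer_eval_mul_Gamma (n : ℕ) {x : ℝ} (hx : 0 < x) :
    (ascPochhammer ℝ n).eval x * Real.Gamma x = Real.Gamma (x + n) := by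
  induction n with
  | zero => simp
  | succ n ih =>
    rw [ascPochhammer_succ_eval, Nat.cast_succ, ← add_assoc,
      Real.Gamma_add_one (by positivity), ← ih]
    ring

theorem ascPochhammer_eval_one_sub (r : ℕ) (c : ℝ) :
    (ascPochhammer ℝ r).eval (1 - c) * (-1) ^ r = (ascPochhammer ℝ r).eval (c - r) := by
  rw [show 1 - c = -(c - 1) by ring, ascPochhammer_eval_neg_eq_descPochhammer,
    descPochhammer_eval_eq_ascPochhammer, mul_right_comm, ← mul_pow]
  norm_num
  ring_nf

/-- The series is (1+X)^(c-1) (1-X). The factor c - 2(r+1) vanishes at c = 2(r+1), which is what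
makes the Lagrange inversion below work. -/
theorem coeff_succ_negPowSeries_mul_one_sub_X (r : ℕ) (c : ℝ) :
    coeff (r + 1) (negPowSeries (1 - c) (-1) * (1 - X)) =
      (c - 2 * (r + 1)) * (ascPochhammer ℝ r).eval (c - r) / ((r + 1).factorial : ℝ) := by
  have h1 : (ascPochhammer ℝ (r + 1)).eval (c - (r + 1 : ℕ)) =
      (c - (r + 1)) * (ascPochhammer ℝ r).eval (c - r) := by
    rw [ascPochhammer_succ_left]
    simp only [Polynomial.eval_mul, Polynomial.eval_X, Polynomial.eval_comp, Polynomial.eval_add,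
      Polynomial.eval_one]
    push_cast
    ring_nf
  rw [mul_sub, mul_one, map_sub, coeff_succ_mul_X]
  simp only [negPowSeries, coeff_mk]
  rw [div_mul_eq_mul_div, div_mul_eq_mul_div, ascPochhammer_eval_one_sub,
    ascPochhammer_eval_one_sub, h1, Nat.factorial_succ]
  have h2 : (r.factorial : ℝ) ≠ 0 := by positivity
  push_cast
  field_simp
  ring

theorem coeff_negPowSeries_mul_one_sub_X (r : ℕ) {c : ℝ} (hc : 2 * r < c) :
    coeff r (negPowSeries (1 - c) (-1) * (1 - X)) =
      Real.Gamma c * ((c - 2 * r) / ((r.factorial : ℝ) * Real.Gamma (c - r + 1))) := by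
  have hc0 : 0 < c := lt_of_le_of_lt (by positivity) hc
  rcases r with _ | r
  · have h1 : Real.Gamma c ≠ 0 := (Real.Gamma_pos_of_pos hc0).ne'
    simp [negPowSeries, Real.Gamma_add_one hc0.ne', mul_sub]
    field_simp
  · push_cast at hc
    have hr : 0 < c - r := by
      have : (0 : ℝ) ≤ r := by positivity
      linarith
    have h1 : Real.Gamma (c - r) ≠ 0 := (Real.Gamma_pos_of_pos hr).ne'
    have h2 := ascPochhammer_eval_mul_Gamma r hr
    rw [sub_add_cancel] at h2
    rw [coeff_succ_negPowSeries_mul_one_sub_X, ← h2]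
    push_cast
    rw [show c - (r + 1 : ℝ) + 1 = c - r by ring]
    field_simp

/-- Lagrange inversion for the substitution `X / (1 + X) ^ 2`. -/
theorem coeff_eq_coeff_subst_mul (A : PowerSeries ℝ) (n : ℕ) :
    coeff n A = coeff n (A.subst (X * negPowSeries 2 (-1)) *
      (negPowSeries (1 - 2 * n) (-1) * (1 - X))) := by
  -- The m-th term carries the coefficient of degree n - m in (1+X)^(2(n-m)-1) (1-X), which is 0 for
  -- m < n and 1 for m = n.
  rw [coeff_subst_X_mul_mul, Finset.sum_range_succ, Finset.sum_eq_zero, zero_add]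
  · rw [negPowSeries_pow, ← mul_assoc, negPowSeries_mul,
      show (n : ℝ) * 2 + (1 - 2 * n) = 1 by ring]
    simp [negPowSeries]
  · intro m hm
    have hm' : m < n := Finset.mem_range.mp hm
    obtain ⟨r, rfl⟩ : ∃ r, n = m + (r + 1) := ⟨n - m - 1, by omega⟩
    rw [negPowSeries_pow, ← mul_assoc, negPowSeries_mul, Nat.add_sub_cancel_left,
      show (m : ℝ) * 2 + (1 - 2 * ((m + (r + 1) : ℕ) : ℝ)) = 1 - 2 * (r + 1) by push_cast; ring,
      coeff_succ_negPowSeries_mul_one_sub_X]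
    simp

/-- Both sides are the power -k of one series, since (1+t)² - 4cos²(θ) t = 1 - 2cos(2θ) t + t². -/
theorem prod_negPowSeries_subst {k : ℝ} (hk : 0 < k) {p : ℕ} (hp : 0 < p) (φ : ℝ) :
    (∏ s : Fin p, negPowSeries k
        (4 * Real.cos (φ + ((s : ℕ) + 1 : ℝ) * Real.pi / p) ^ 2)).subst
          (X * negPowSeries 2 (-1)) =
      negPowSeries (-(2 * p * k)) (-1) *
        (gegenbauerSeries k (Real.cos (2 * p * φ))).subst (X ^ p : PowerSeries ℝ) := by
  have hs : HasSubst (X * negPowSeries 2 (-1) : PowerSeries ℝ) :=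
    HasSubst.of_constantCoeff_zero' (by simp)
  have hsp : HasSubst (X ^ p : PowerSeries ℝ) := HasSubst.X_pow hp.ne'
  have h₁ := (IsNegPow.prod (s := Finset.univ) fun (s : Fin p) _ => isNegPow_negPowSeries k
    (4 * Real.cos (φ + ((s : ℕ) + 1 : ℝ) * Real.pi / p) ^ 2)).subst
      (g := X * negPowSeries 2 (-1)) (by simp)
  have h₂ := (isNegPow_negPowSeries_power (2 * p) (-1) k).mul
    ((isNegPow_gegenbauerSeries hk (Real.cos (2 * p * φ))).subst
      (g := X ^ p) (by simp [hp.ne']))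
  refine h₁.unique ?_
  convert h₂ using 1
  have hone : ∀ g : PowerSeries ℝ, HasSubst g → (1 : PowerSeries ℝ).subst g = 1 := by
    intro g hg
    rw [← coe_substAlgHom hg, map_one]
  have hC : ∀ (g : PowerSeries ℝ) (r : ℝ), (C r : PowerSeries ℝ).subst g = C r :=
    fun g r => subst_C r
  have hX : ∀ g : PowerSeries ℝ, HasSubst g → (X : PowerSeries ℝ).subst g = g :=
    fun g hg => subst_X hg
  rw [subst_add hsp, subst_sub hsp, subst_mul hsp, subst_pow hsp, hone _ hsp, hC, hX _ hsp,
    ← pow_mul, mul_comm p 2, show 2 * (p : ℝ) * φ = p * (2 * φ) by ring,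
    ← prod_one_sub_two_cos_mul_X_add_X_sq hp (2 * φ), mul_comm (2 : ℝ) (p : ℝ), ← negPowSeries_pow]
  rw [← coe_substAlgHom hs, map_prod]
  have hpow : negPowSeries 2 (-1) ^ p = ∏ _s : Fin p, negPowSeries 2 (-1) := by simp
  rw [hpow, ← Finset.prod_mul_distrib]
  refine Finset.prod_congr rfl fun s _ => ?_
  rw [coe_substAlgHom hs, subst_sub hs, subst_mul hs, hone _ hs, hC, hX _ hs]
  have h2 : negPowSeries 2 (-1) * negPowSeries (-2) (-1) = 1 := by
    rw [negPowSeries_mul]; norm_num [negPowSeries_zero]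
  have h3 : negPowSeries (-2) (-1) = (1 + X) ^ 2 := by
    have := negPowSeries_pow (-1) (-1) 2
    rw [negPowSeries_neg_one, map_neg, map_one, neg_one_mul, sub_neg_eq_add] at this
    rw [this]; norm_num
  have h4 : (C (4 * Real.cos (φ + ((s : ℕ) + 1 : ℝ) * Real.pi / p) ^ 2) : PowerSeries ℝ) =
      C (2 * Real.cos (2 * φ + 2 * (((s : ℕ) + 1 : ℝ) * Real.pi / p))) + 2 := by
    rw [show (2 : PowerSeries ℝ) = C 2 from (map_ofNat C 2).symm, ← map_add, ← mul_add,
      Real.cos_two_mul]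
    congr 1; ring
  rw [h4]
  rw [h3] at h2
  linear_combination -h2

/-- The coefficients of `∏ₛ (1 - 4 cos² (φ + s π / p) X) ^ (-k)` in terms of Gegenbauer
polynomials. -/
theorem coeff_prod_negPowSeries {k : ℝ} (hk : 0 < k) {p : ℕ} (hp : 0 < p) (φ : ℝ) (n : ℕ) :
    coeff n (∏ s : Fin p, negPowSeries k
        (4 * Real.cos (φ + ((s : ℕ) + 1 : ℝ) * Real.pi / p) ^ 2)) =
      Real.Gamma (2 * n + 2 * p * k) * ∑ j ∈ Finset.range (n + 1), if p * j ≤ n then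
        2 * p * (j + k) / (((n - p * j).factorial : ℝ) * Real.Gamma (n + p * j + 2 * p * k + 1)) *
          gegenbauerC k j (Real.cos (2 * p * φ)) else 0 := by
  rw [coeff_eq_coeff_subst_mul, prod_negPowSeries_subst hk hp]
  -- The powers of 1+X merge into exponent c - 1 with c = 2n + 2pk. With r = n - pj this gives c -
  -- 2r = 2p(j+k). Writing X^p as X · X^(p-1) matches the form of `coeff_subst_X_mul_mul`.
  have e : negPowSeries (-(2 * p * k)) (-1) *
        (gegenbauerSeries k (Real.cos (2 * p * φ))).subst (X ^ p : PowerSeries ℝ) *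
        (negPowSeries (1 - 2 * n) (-1) * (1 - X)) =
      (gegenbauerSeries k (Real.cos (2 * p * φ))).subst (X * X ^ (p - 1) : PowerSeries ℝ) *
        (negPowSeries (1 - (2 * n + 2 * p * k)) (-1) * (1 - X)) := by
    have h1 : negPowSeries (1 - (2 * n + 2 * p * k)) (-1) =
        negPowSeries (-(2 * p * k)) (-1) * negPowSeries (1 - 2 * n) (-1) := by
      rw [negPowSeries_mul]; ring_nf
    rw [← pow_succ', Nat.sub_add_cancel hp, h1]
    ring
  rw [e, coeff_subst_X_mul_mul, Finset.mul_sum]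
  refine Finset.sum_congr rfl fun j hj => ?_
  have hj' : j ≤ n := by simpa [Nat.lt_succ_iff] using hj
  have hpj : p * j = (p - 1) * j + j := by
    conv_lhs => rw [← Nat.sub_add_cancel hp]
    ring
  rw [← pow_mul, coeff_X_pow_mul', gegenbauerSeries, coeff_mk]
  by_cases h : p * j ≤ n
  · rw [if_pos (by omega), if_pos h, show n - j - (p - 1) * j = n - p * j by omega,
      coeff_negPowSeries_mul_one_sub_X]
    · rw [Nat.cast_sub h]
      push_cast
      rw [show (2 * (n : ℝ) + 2 * p * k - 2 * (n - p * j)) = 2 * p * (j + k) by ring,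
        show (2 * (n : ℝ) + 2 * p * k - (n - p * j) + 1) = n + p * j + 2 * p * k + 1 by ring]
      ring
    · rw [Nat.cast_sub h]
      push_cast
      have : 0 < (p : ℝ) * k := by positivity
      have : 0 ≤ (p : ℝ) * j := by positivity
      linarith
  · rw [if_neg (by omega), if_neg h]
    simp

end LagrangeInversion

/-! ### Dirichlet's integral over the simplex -/

section DirichletIntegral

open ProbabilityTheory

theorem lintegral_rpow_mul_rpow_sub {a b T : ℝ} (ha : 0 < a) (hb : 0 < b) (hT : 0 < T) :
    ∫⁻ x in Set.Ioo 0 T, ENNReal.ofReal (x ^ (a - 1) * (T - x) ^ (b - 1)) =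
      ENNReal.ofReal (T ^ (a + b - 1) * (Real.Gamma a * Real.Gamma b / Real.Gamma (a + b))) := by
  rw [← lintegral_indicator measurableSet_Ioo]
  have hm : Measurable ((Set.Ioo 0 T).indicator
      fun x : ℝ => ENNReal.ofReal (x ^ (a - 1) * (T - x) ^ (b - 1))) :=
    Measurable.indicator (by fun_prop) measurableSet_Ioo
  have hbeta : 0 < beta a b := beta_pos ha hb
  have hpt : ∀ x : ℝ, (Set.Ioo 0 T).indicator
      (fun x : ℝ => ENNReal.ofReal (x ^ (a - 1) * (T - x) ^ (b - 1))) (T * x) =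
      ENNReal.ofReal (T ^ (a + b - 2) * beta a b) * betaPDF a b x := by
    intro x
    by_cases hx : 0 < x ∧ x < 1
    · have h1 : T * x ∈ Set.Ioo 0 T := ⟨by have := hx.1; positivity, by nlinarith [hx.2]⟩
      rw [Set.indicator_of_mem h1, betaPDF_of_pos_lt_one hx.1 hx.2,
        ← ENNReal.ofReal_mul (by positivity), show T - T * x = T * (1 - x) by ring,
        Real.mul_rpow hT.le hx.1.le, Real.mul_rpow hT.le (by linarith [hx.2]),
        show a + b - 2 = (a - 1) + (b - 1) by ring, Real.rpow_add hT]
      congr 1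
      field_simp
    · have h1 : T * x ∉ Set.Ioo 0 T := fun h =>
        hx ⟨(mul_pos_iff_of_pos_left hT).mp h.1, by nlinarith [h.2]⟩
      rw [Set.indicator_of_notMem h1, betaPDF_eq, if_neg hx]
      simp
  conv_lhs => rw [← Real.smul_map_volume_mul_left hT.ne']
  rw [lintegral_smul_measure, lintegral_map hm (measurable_const_mul T)]
  simp_rw [hpt]
  rw [lintegral_const_mul' _ _ ENNReal.ofReal_ne_top, lintegral_betaPDF_eq_one ha hb, mul_one,
    smul_eq_mul, ← ENNReal.ofReal_mul (abs_nonneg T), abs_of_pos hT]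
  congr 1
  rw [show a + b - 1 = (a + b - 2) + 1 by ring, Real.rpow_add_one hT.ne', beta]
  ring

/-- The Dirichlet density on the simplex `x ≥ 0`, `∑ x ≤ T`, extended by zero. -/
noncomputable def dirichletWeight {q : ℕ} (a : Fin q → ℝ) (b T : ℝ) (x : Fin q → ℝ) : ENNReal :=
  {x : Fin q → ℝ | (∀ i, 0 ≤ x i) ∧ ∑ i, x i ≤ T}.indicator
    (fun x => ENNReal.ofReal ((∏ i, x i ^ (a i - 1)) * (T - ∑ i, x i) ^ (b - 1))) x

theorem measurableSet_scaledSimplex (q : ℕ) (T : ℝ) :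
    MeasurableSet {x : Fin q → ℝ | (∀ i, 0 ≤ x i) ∧ ∑ i, x i ≤ T} := by
  have h : {x : Fin q → ℝ | (∀ i, 0 ≤ x i) ∧ ∑ i, x i ≤ T} =
      (⋂ i, {x : Fin q → ℝ | 0 ≤ x i}) ∩ {x : Fin q → ℝ | ∑ i, x i ≤ T} := by
    ext x
    simp
  rw [h]
  refine MeasurableSet.inter (MeasurableSet.iInter fun i => ?_) ?_
  · exact measurableSet_le measurable_const (measurable_pi_apply i)
  · exact measurableSet_le (f := fun x : Fin q → ℝ => ∑ i, x i) (by fun_prop) measurable_const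

theorem measurable_dirichletWeight {q : ℕ} (a : Fin q → ℝ) (b T : ℝ) :
    Measurable (dirichletWeight a b T) :=
  Measurable.indicator (by fun_prop) (measurableSet_scaledSimplex q T)

/-- Fixing the first coordinate leaves a Dirichlet weight on a simplex of size T - x₀; this drives
the induction on dimension. -/
theorem dirichletWeight_cons {q : ℕ} (a : Fin (q + 1) → ℝ) (b T x₀ : ℝ) (y : Fin q → ℝ) :
    dirichletWeight a b T (Fin.cons x₀ y) =
      (Set.Ici (0 : ℝ)).indicator (fun x => ENNReal.ofReal (x ^ (a 0 - 1))) x₀ *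
        dirichletWeight (fun i => a i.succ) b (T - x₀) y := by
  unfold dirichletWeight
  by_cases h₀ : 0 ≤ x₀
  · rw [Set.indicator_of_mem (show x₀ ∈ Set.Ici 0 from h₀)]
    by_cases hy : (∀ i, 0 ≤ y i) ∧ ∑ i, y i ≤ T - x₀
    · rw [Set.indicator_of_mem, Set.indicator_of_mem (by exact hy),
        ← ENNReal.ofReal_mul (by positivity)]
      · congr 1
        simp only [Fin.prod_univ_succ, Fin.sum_univ_succ, Fin.cons_zero, Fin.cons_succ]
        rw [sub_sub, mul_assoc]
      · refine ⟨fun i => Fin.cases h₀ hy.1 i, ?_⟩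
        simp only [Fin.sum_univ_succ, Fin.cons_zero, Fin.cons_succ]
        linarith [hy.2]
    · rw [Set.indicator_of_notMem, Set.indicator_of_notMem (by exact hy), mul_zero]
      rintro ⟨h1, h2⟩
      refine hy ⟨fun i => by simpa using h1 i.succ, ?_⟩
      simp only [Fin.sum_univ_succ, Fin.cons_zero, Fin.cons_succ] at h2
      linarith
  · rw [Set.indicator_of_notMem (show x₀ ∉ Set.Ici 0 from h₀), zero_mul, Set.indicator_of_notMem]
    rintro ⟨h1, -⟩
    exact h₀ (by simpa using h1 0)

/-- Dirichlet's integral over the simplex `x ≥ 0`, `∑ x ≤ T`. -/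
theorem lintegral_dirichletWeight {q : ℕ} (a : Fin q → ℝ) (ha : ∀ i, 0 < a i) {b T : ℝ}
    (hb : 0 < b) (hT : 0 < T) :
    ∫⁻ x, dirichletWeight a b T x =
      ENNReal.ofReal (T ^ (∑ i, a i + b - 1) *
        ((∏ i, Real.Gamma (a i)) * Real.Gamma b / Real.Gamma (∑ i, a i + b))) := by
  induction q generalizing T with
  | zero =>
    have h1 : Real.Gamma b ≠ 0 := (Real.Gamma_pos_of_pos hb).ne'
    rw [volume_pi, lintegral_unique]
    simp [dirichletWeight, hT.le, h1]
  | succ q ih =>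
    have hS : 0 < ∑ i : Fin q, a i.succ + b :=
      add_pos_of_nonneg_of_pos (Finset.sum_nonneg fun i _ => (ha _).le) hb
    set S := ∑ i : Fin q, a i.succ + b with hSdef
    set G := (∏ i : Fin q, Real.Gamma (a i.succ)) * Real.Gamma b / Real.Gamma S with hG
    have hG0 : 0 ≤ G := by
      have : 0 < Real.Gamma b := Real.Gamma_pos_of_pos hb
      have : 0 < Real.Gamma S := Real.Gamma_pos_of_pos hS
      have : 0 ≤ ∏ i : Fin q, Real.Gamma (a i.succ) :=
        Finset.prod_nonneg fun i _ => (Real.Gamma_pos_of_pos (ha _)).le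
      positivity
    have hmp := (volume_preserving_piFinSuccAbove (fun _ : Fin (q + 1) => ℝ) 0).symm
    rw [← hmp.lintegral_comp_emb (MeasurableEquiv.measurableEmbedding _)]
    have hcons : ∀ z : ℝ × (Fin q → ℝ),
        (MeasurableEquiv.piFinSuccAbove (fun _ : Fin (q + 1) => ℝ) 0).symm z =
          Fin.cons z.1 z.2 := by
      intro z
      simp [MeasurableEquiv.piFinSuccAbove, Fin.insertNthEquiv]
    have hmz : Measurable fun z : ℝ × (Fin q → ℝ) => dirichletWeight a b T (Fin.cons z.1 z.2) := by
      have h := (measurable_dirichletWeight a b T).comp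
        (MeasurableEquiv.piFinSuccAbove (fun _ : Fin (q + 1) => ℝ) 0).symm.measurable
      convert h using 2 with z
      exact congrArg _ (hcons z).symm
    simp_rw [hcons]
    rw [Measure.volume_eq_prod, lintegral_prod _ hmz.aemeasurable]
    simp_rw [dirichletWeight_cons]
    -- The inductive hypothesis needs T - x₀ > 0, so the null set {0, T} is discarded and the
    -- remaining integral is a beta integral on the open interval.
    have hpt : ∀ᵐ x₀ : ℝ, ∫⁻ y : Fin q → ℝ,
        (Set.Ici (0 : ℝ)).indicator (fun x => ENNReal.ofReal (x ^ (a 0 - 1))) x₀ *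
          dirichletWeight (fun i => a i.succ) b (T - x₀) y =
        ENNReal.ofReal G * (Set.Ioo 0 T).indicator
          (fun x => ENNReal.ofReal (x ^ (a 0 - 1) * (T - x) ^ (S - 1))) x₀ := by
      filter_upwards [Measure.ae_ne volume (0 : ℝ), Measure.ae_ne volume T] with x₀ h₀ hxT
      rw [lintegral_const_mul _ (measurable_dirichletWeight _ _ _)]
      by_cases hx : 0 ≤ x₀
      · rcases lt_or_gt_of_ne hxT with hlt | hgt
        · rw [ih (fun i => a i.succ) (fun i => ha _) (sub_pos.mpr hlt),
            Set.indicator_of_mem (show x₀ ∈ Set.Ici 0 from hx),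
            Set.indicator_of_mem (show x₀ ∈ Set.Ioo 0 T from ⟨lt_of_le_of_ne hx (Ne.symm h₀), hlt⟩),
            ← ENNReal.ofReal_mul (by positivity), ← ENNReal.ofReal_mul hG0]
          congr 1
          rw [← hSdef, ← hG]
          ring
        · have hz : ∀ y : Fin q → ℝ, dirichletWeight (fun i => a i.succ) b (T - x₀) y = 0 := by
            intro y
            refine Set.indicator_of_notMem ?_ _
            rintro ⟨h1, h2⟩
            have := Finset.sum_nonneg fun i (_ : i ∈ Finset.univ) => h1 i
            linarith
          rw [Set.indicator_of_notMem (show x₀ ∉ Set.Ioo 0 T from fun h => absurd h.2 (by linarith))]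
          simp [hz]
      · rw [Set.indicator_of_notMem (show x₀ ∉ Set.Ici 0 from hx),
          Set.indicator_of_notMem (show x₀ ∉ Set.Ioo 0 T from fun h => hx h.1.le)]
        simp
    rw [lintegral_congr_ae hpt, lintegral_const_mul' _ _ ENNReal.ofReal_ne_top,
      lintegral_indicator measurableSet_Ioo, lintegral_rpow_mul_rpow_sub (ha 0) hS hT,
      ← ENNReal.ofReal_mul hG0]
    congr 1
    rw [Fin.sum_univ_succ, Fin.prod_univ_succ, add_assoc, ← hSdef, hG]
    have : Real.Gamma S ≠ 0 := (Real.Gamma_pos_of_pos hS).ne'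
    field_simp

theorem simplexDomain_succ (q : ℕ) :
    simplexDomain (q + 1) = {x : Fin q → ℝ | (∀ i, 0 ≤ x i) ∧ ∑ i, x i ≤ 1} := by
  ext x
  simp only [simplexDomain, stdSimplex, Set.mem_ofPred_eq, Fin.forall_fin_succ', Fin.sum_univ_castSucc]
  simp [simplexPoint]

theorem simplexPoint_castSucc {q : ℕ} (x : Fin q → ℝ) (i : Fin q) :
    simplexPoint (q + 1) x i.castSucc = x i := by
  simp [simplexPoint]

theorem simplexPoint_last {q : ℕ} (x : Fin q → ℝ) :
    simplexPoint (q + 1) x (Fin.last q) = 1 - ∑ i, x i := by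
  simp [simplexPoint]

theorem measurableSet_simplexDomain (p : ℕ) (hp : 0 < p) : MeasurableSet (simplexDomain p) := by
  obtain ⟨q, rfl⟩ : ∃ q, p = q + 1 := ⟨p - 1, by omega⟩
  rw [simplexDomain_succ]
  exact measurableSet_scaledSimplex q 1

theorem measurable_simplexPoint (p : ℕ) : Measurable (simplexPoint p) := by
  refine measurable_pi_lambda _ fun s => ?_
  unfold simplexPoint
  split_ifs <;> fun_prop

theorem dirichlet_integral {p : ℕ} (hp : 0 < p) (a : Fin p → ℝ) (ha : ∀ s, 0 < a s) :
    IntegrableOn (fun x => ∏ s, simplexPoint p x s ^ (a s - 1)) (simplexDomain p) ∧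
      ∫ x in simplexDomain p, ∏ s, simplexPoint p x s ^ (a s - 1) =
        (∏ s, Real.Gamma (a s)) / Real.Gamma (∑ s, a s) := by
  have hmeas : AEStronglyMeasurable (fun x => ∏ s, simplexPoint p x s ^ (a s - 1))
      (volume.restrict (simplexDomain p)) := by
    refine Measurable.aestronglyMeasurable ?_
    exact Finset.measurable_prod _ fun s _ =>
      ((measurable_pi_apply s).comp (measurable_simplexPoint p)).pow_const _
  have hnn : 0 ≤ᵐ[volume.restrict (simplexDomain p)]
      fun x => ∏ s, simplexPoint p x s ^ (a s - 1) := by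
    refine ae_restrict_of_forall_mem (measurableSet_simplexDomain p hp) fun x hx => ?_
    exact Finset.prod_nonneg fun s _ => Real.rpow_nonneg (hx.1 s) _
  have hlint : ∫⁻ x in simplexDomain p,
      ENNReal.ofReal (∏ s, simplexPoint p x s ^ (a s - 1)) =
        ENNReal.ofReal ((∏ s, Real.Gamma (a s)) / Real.Gamma (∑ s, a s)) := by
    obtain ⟨q, rfl⟩ : ∃ q, p = q + 1 := ⟨p - 1, by omega⟩
    rw [← lintegral_indicator (measurableSet_simplexDomain _ hp)]
    have h := lintegral_dirichletWeight (fun i : Fin q => a i.castSucc) (fun i => ha _)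
      (ha (Fin.last q)) one_pos
    rw [Fin.prod_univ_castSucc, Fin.sum_univ_castSucc]
    rw [Real.one_rpow, one_mul] at h
    rw [← h]
    refine lintegral_congr fun x => ?_
    rw [simplexDomain_succ]
    unfold dirichletWeight
    congr 1
    ext y
    rw [Fin.prod_univ_castSucc]
    simp_rw [simplexPoint_castSucc, simplexPoint_last]
  have hval : 0 ≤ (∏ s, Real.Gamma (a s)) / Real.Gamma (∑ s, a s) := by
    refine div_nonneg (Finset.prod_nonneg fun s _ => (Real.Gamma_pos_of_pos (ha s)).le) ?_
    exact Real.Gamma_nonneg_of_nonneg (Finset.sum_nonneg fun s _ => (ha s).le)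
  refine ⟨⟨hmeas, ?_⟩, ?_⟩
  · rw [hasFiniteIntegral_iff_ofReal hnn, hlint]
    exact ENNReal.ofReal_lt_top
  · rw [integral_eq_lintegral_of_nonneg_ae hnn hmeas, hlint, ENNReal.toReal_ofReal hval]

end DirichletIntegral

/-! ### Moments of linear forms under the Dirichlet weight -/

section Moments

theorem rpow_sub_one_mul_pow {k u : ℝ} (hk : 0 < k) (hu : 0 ≤ u) (m : ℕ) :
    u ^ (k - 1) * u ^ m = u ^ (k + m - 1) := by
  rcases hu.eq_or_lt with rfl | hu
  · rcases m with _ | m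
    · simp
    · have : k + ((m + 1 : ℕ) : ℝ) - 1 ≠ 0 := by
        push_cast
        have : (0 : ℝ) ≤ m := by positivity
        linarith
      rw [Real.zero_rpow this]
      simp
  · rw [← Real.rpow_natCast, ← Real.rpow_add hu]
    ring_nf

theorem coeff_prod_negPowSeries_eq_sum {p : ℕ} (k : ℝ) (y : Fin p → ℝ) (n : ℕ) :
    PowerSeries.coeff n (∏ s, negPowSeries k (y s)) =
      ∑ m ∈ Finset.piAntidiag Finset.univ n,
        ∏ s, ((ascPochhammer ℝ (m s)).eval k / ((m s).factorial : ℝ) * y s ^ m s) := by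
  rw [PowerSeries.coeff_prod]
  refine Finset.sum_equiv Finsupp.equivFunOnFinite ?_ ?_
  · intro l
    simp [Finset.mem_finsuppAntidiag, Finset.mem_piAntidiag]
  · intro l _
    simp [negPowSeries]

/-- In the multinomial expansion each monomial shifts the Dirichlet exponents to k + m_s. All terms
share the denominator Γ(pk+n), and the ratios Γ(k+m_s)/(Γ(k) m_s!) are the binomial coefficients of
(1 - y_s X)^(-k). -/
theorem dirichlet_moment {p : ℕ} (hp : 0 < p) {k : ℝ} (hk : 0 < k) (y : Fin p → ℝ) (n : ℕ) :
    ∫ x in simplexDomain p, (∏ s, simplexPoint p x s ^ (k - 1)) *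
        (∑ s, simplexPoint p x s * y s) ^ n =
      Real.Gamma k ^ p * n.factorial / Real.Gamma (p * k + n) *
        PowerSeries.coeff n (∏ s, negPowSeries k (y s)) := by
  have hpt : ∀ x ∈ simplexDomain p, (∏ s, simplexPoint p x s ^ (k - 1)) *
        (∑ s, simplexPoint p x s * y s) ^ n =
      ∑ m ∈ Finset.piAntidiag Finset.univ n, (Nat.multinomial Finset.univ m * ∏ s, y s ^ m s) *
        ∏ s, simplexPoint p x s ^ (k + m s - 1) := by
    intro x hx
    rw [Finset.sum_pow_eq_sum_piAntidiag, Finset.mul_sum]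
    refine Finset.sum_congr rfl fun m _ => ?_
    have h1 : ∏ s, simplexPoint p x s ^ (k + m s - 1) =
        (∏ s, simplexPoint p x s ^ (k - 1)) * ∏ s, simplexPoint p x s ^ m s := by
      rw [← Finset.prod_mul_distrib]
      exact Finset.prod_congr rfl fun s _ => (rpow_sub_one_mul_pow hk (hx.1 s) (m s)).symm
    rw [h1]
    simp_rw [mul_pow]
    rw [Finset.prod_mul_distrib]
    ring
  have hpos : ∀ m : Fin p → ℕ, ∀ s, 0 < k + (m s : ℝ) := fun m s => by positivity
  rw [setIntegral_congr_fun (measurableSet_simplexDomain p hp) hpt, integral_finsetSum]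
  · rw [coeff_prod_negPowSeries_eq_sum, Finset.mul_sum]
    refine Finset.sum_congr rfl fun m hm => ?_
    have hmn : ∑ s, m s = n := by simpa using (Finset.mem_piAntidiag.mp hm).1
    rw [integral_const_mul, (dirichlet_integral hp (fun s => k + m s) (hpos m)).2]
    have hsum : ∑ s, (k + (m s : ℝ)) = p * k + n := by
      rw [Finset.sum_add_distrib, ← hmn]
      simp
    have hΓ : ∏ s, Real.Gamma (k + (m s : ℝ)) =
        (∏ s, (ascPochhammer ℝ (m s)).eval k) * Real.Gamma k ^ p := by
      simp_rw [← ascPochhammer_eval_mul_Gamma _ hk]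
      rw [Finset.prod_mul_distrib]
      simp
    have hmul : (∏ s, ((m s).factorial : ℝ)) * Nat.multinomial Finset.univ m = n.factorial := by
      rw [← hmn]
      exact_mod_cast Nat.multinomial_spec Finset.univ m
    have hfac : (∏ s, ((m s).factorial : ℝ)) ≠ 0 :=
      Finset.prod_ne_zero_iff.mpr fun s _ => by positivity
    rw [hsum, hΓ, ← hmul, Finset.prod_mul_distrib, Finset.prod_div_distrib]
    field_simp
  · intro m _
    exact ((dirichlet_integral hp (fun s => k + m s) (hpos m)).1).const_mul _

end Moments

/-! ### Convergence and termwise integration of ₁F₁ -/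

section Confluent

/-- Each ratio (a+i)/(c+i) is at most 1 + a/c; this compares ₁F₁ with an exponential series. -/
theorem ascPochhammer_eval_le {a c : ℝ} (ha : 0 < a) (hc : 0 < c) (n : ℕ) :
    (ascPochhammer ℝ n).eval a / (ascPochhammer ℝ n).eval c ≤ (1 + a / c) ^ n := by
  have hpos := ascPochhammer_pos n c hc
  rw [div_le_iff₀ hpos]
  clear hpos
  induction n with
  | zero => simp
  | succ n ih =>
    have h1 : a + n ≤ (1 + a / c) * (c + n) := by
      have e : (1 + a / c) * (c + n) = a + n + (c + a / c * n) := by field_simp; ring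
      rw [e]
      have : 0 ≤ c + a / c * n := by positivity
      linarith
    have h2 := (ascPochhammer_pos n a ha).le
    have h3 := (ascPochhammer_pos n c hc).le
    rw [ascPochhammer_succ_eval, ascPochhammer_succ_eval, pow_succ]
    calc _ ≤ ((1 + a / c) ^ n * (ascPochhammer ℝ n).eval c) * ((1 + a / c) * (c + n)) := by
          gcongr
      _ = _ := by ring

theorem summable_confluentHypergeometric_abs {a c : ℝ} (ha : 0 < a) (hc : 0 < c) (M : ℝ) :
    Summable fun n : ℕ => (ascPochhammer ℝ n).eval a / (ascPochhammer ℝ n).eval c *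
      (|M| ^ n / (n.factorial : ℝ)) := by
  refine Summable.of_nonneg_of_le (fun n => ?_) (fun n => ?_)
    (Real.summable_pow_div_factorial ((1 + a / c) * |M|))
  · have := ascPochhammer_pos n a ha
    have := ascPochhammer_pos n c hc
    positivity
  · rw [mul_pow, mul_div_assoc]
    gcongr
    exact ascPochhammer_eval_le ha hc n

theorem hasSum_confluentHypergeometric {a c : ℝ} (ha : 0 < a) (hc : 0 < c) (z : ℝ) :
    HasSum (fun n : ℕ => (ascPochhammer ℝ n).eval a / (ascPochhammer ℝ n).eval c *
      (z ^ n / (n.factorial : ℝ))) (confluentHypergeometric a c z) := by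
  refine Summable.hasSum (Summable.of_norm ?_)
  convert summable_confluentHypergeometric_abs ha hc z using 2 with n
  have := ascPochhammer_pos n a ha
  have := ascPochhammer_pos n c hc
  rw [norm_mul, Real.norm_of_nonneg (by positivity), norm_div, norm_pow, Real.norm_eq_abs,
    Real.norm_of_nonneg (by positivity : (0 : ℝ) ≤ n.factorial)]

theorem measurable_confluentHypergeometric {a c : ℝ} (ha : 0 < a) (hc : 0 < c) :
    Measurable (confluentHypergeometric a c) := by
  refine measurable_of_tendsto_metrizable (f := fun (N : ℕ) z => ∑ n ∈ Finset.range N,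
    (ascPochhammer ℝ n).eval a / (ascPochhammer ℝ n).eval c * (z ^ n / (n.factorial : ℝ)))
    (fun N => by fun_prop) ?_
  rw [tendsto_pi_nhds]
  exact fun z => (hasSum_confluentHypergeometric ha hc z).tendsto_sum_nat

/-- Termwise integration of a confluent hypergeometric series in a bounded argument. -/
theorem integral_mul_confluentHypergeometric {α : Type*} [MeasurableSpace α] {μ : Measure α}
    {w S : α → ℝ} {a c M : ℝ} (ha : 0 < a) (hc : 0 < c) (hw : Integrable w μ)
    (hS : Measurable S) (hM : ∀ᵐ x ∂μ, |S x| ≤ |M|) :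
    Integrable (fun x => w x * confluentHypergeometric a c (S x)) μ ∧
      HasSum (fun n : ℕ => (ascPochhammer ℝ n).eval a / (ascPochhammer ℝ n).eval c /
          (n.factorial : ℝ) * ∫ x, w x * S x ^ n ∂μ)
        (∫ x, w x * confluentHypergeometric a c (S x) ∂μ) := by
  set e : ℕ → ℝ := fun n => (ascPochhammer ℝ n).eval a / (ascPochhammer ℝ n).eval c with he
  have he0 : ∀ n, 0 ≤ e n := fun n =>
    div_nonneg (ascPochhammer_pos n a ha).le (ascPochhammer_pos n c hc).le
  have hsum := summable_confluentHypergeometric_abs ha hc M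
  have hF : ∀ x, HasSum (fun n => w x * (e n * (S x ^ n / (n.factorial : ℝ))))
      (w x * confluentHypergeometric a c (S x)) := fun x =>
    (hasSum_confluentHypergeometric ha hc (S x)).mul_left _
  have hbound : ∀ n x, |S x| ≤ |M| →
      ‖w x * (e n * (S x ^ n / (n.factorial : ℝ)))‖ ≤ |w x| * (e n * (|M| ^ n / (n.factorial : ℝ))) := by
    intro n x hx
    rw [norm_mul, norm_mul, Real.norm_of_nonneg (he0 n), norm_div, norm_pow, Real.norm_eq_abs,
      Real.norm_eq_abs, Real.norm_of_nonneg (by positivity : (0 : ℝ) ≤ n.factorial)]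
    have := he0 n
    gcongr
  have hint : Integrable (fun x => ∑' n, |w x| * (e n * (|M| ^ n / (n.factorial : ℝ)))) μ := by
    simp_rw [tsum_mul_left]
    exact hw.abs.mul_const _
  refine ⟨?_, ?_⟩
  · refine hint.mono' (hw.aestronglyMeasurable.mul
      ((measurable_confluentHypergeometric ha hc).comp hS).aestronglyMeasurable) ?_
    filter_upwards [hM] with x hx
    rw [← (hF x).tsum_eq]
    exact tsum_of_norm_bounded (hsum.mul_left _).hasSum fun n => hbound n x hx
  · have h := hasSum_integral_of_dominated_convergence
      (F := fun (n : ℕ) x => w x * (e n * (S x ^ n / (n.factorial : ℝ))))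
      (f := fun x => w x * confluentHypergeometric a c (S x)) (μ := μ)
      (fun n x => |w x| * (e n * (|M| ^ n / (n.factorial : ℝ))))
      (fun n => hw.aestronglyMeasurable.mul (by fun_prop))
      (fun n => hM.mono fun x hx => hbound n x hx)
      (.of_forall fun x => hsum.mul_left _) hint (.of_forall hF)
    refine h.congr_fun fun n => ?_
    rw [← integral_const_mul]
    congr 1
    ext x
    ring

end Confluent

/-! ### A geometric bound for Gegenbauer polynomials -/

section GegenbauerBound

open PowerSeries

theorem gegenbauerC_zero {k : ℝ} (hk : 0 < k) (y : ℝ) : gegenbauerC k 0 y = 1 := by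
  simp [gegenbauerC_eq_sum hk]

theorem gegenbauerC_one {k : ℝ} (hk : 0 < k) (y : ℝ) : gegenbauerC k 1 y = 2 * k * y := by
  simp [gegenbauerC_eq_sum hk, Finset.sum_range_succ]
  ring

/-- This is the coefficient of degree j+1 in the differential equation of the generating function.
-/
theorem gegenbauerC_recurrence {k : ℝ} (hk : 0 < k) (y : ℝ) (j : ℕ) :
    (j + 2) * gegenbauerC k (j + 2) y =
      2 * y * (j + 1 + k) * gegenbauerC k (j + 1) y - (j + 2 * k) * gegenbauerC k j y := by
  have h := (isNegPow_gegenbauerSeries hk y).3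
  set U := gegenbauerSeries k y with hU
  have hd : derivative ℝ (1 - C (2 * y) * X + X ^ 2) = - C (2 * y) + 2 * X := by
    simp [pow_two, two_mul]
  have e : (1 - C (2 * y) * X + X ^ 2) * derivative ℝ U + C k * (- C (2 * y) + 2 * X) * U =
      derivative ℝ U - C (2 * y) * (X * derivative ℝ U) + X * (X * derivative ℝ U)
        - C (2 * y * k) * U + C (2 * k) * (X * U) := by
    simp only [map_mul, map_ofNat]
    ring
  rw [hd, e] at h
  have hc := congrArg (coeff (j + 1)) h
  have hX : coeff j (X * derivative ℝ U) = j * gegenbauerC k j y := by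
    rcases j with _ | j
    · simp
    · simp [coeff_derivative, hU, gegenbauerSeries]
      ring
  simp only [map_add, map_sub, coeff_C_mul, coeff_succ_X_mul, hX, map_zero] at hc
  simp only [coeff_derivative, hU, gegenbauerSeries, coeff_mk] at hc
  push_cast at hc
  linear_combination hc

theorem abs_gegenbauerC_le {k : ℝ} (hk : 0 < k) {y : ℝ} (hy : |y| ≤ 1) (j : ℕ) :
    |gegenbauerC k j y| ≤ (4 * (1 + k)) ^ j := by
  induction j using Nat.twoStepInduction with
  | zero => simp [gegenbauerC_zero hk]
  | one =>
    rw [gegenbauerC_one hk, abs_mul, abs_of_pos (by positivity), pow_one]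
    nlinarith [abs_nonneg y]
  | more j ih₀ ih₁ =>
    set B := 4 * (1 + k) with hB
    have hj : (0 : ℝ) ≤ j := by positivity
    have h1 : (j + 2) * |gegenbauerC k (j + 2) y| ≤
        2 * (j + 1 + k) * B ^ (j + 1) + (j + 2 * k) * B ^ j := by
      have e : (j + 2) * |gegenbauerC k (j + 2) y| = |(j + 2) * gegenbauerC k (j + 2) y| := by
        rw [abs_mul, abs_of_pos (by positivity : (0 : ℝ) < j + 2)]
      rw [e, gegenbauerC_recurrence hk]
      refine (abs_sub _ _).trans ?_
      rw [abs_mul, abs_mul, abs_mul, abs_mul, abs_of_pos (by positivity : (0 : ℝ) < j + 1 + k),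
        abs_of_pos (by positivity : (0 : ℝ) < j + 2 * k), abs_two]
      have : 2 * |y| * (j + 1 + k) ≤ 2 * (j + 1 + k) := by
        have : 0 < (j : ℝ) + 1 + k := by positivity
        nlinarith
      gcongr
    have h2 : 2 * (j + 1 + k) * B ^ (j + 1) + (j + 2 * k) * B ^ j ≤ (j + 2) * B ^ (j + 2) := by
      have h3 : 2 * (j + 1 + k) * B + (j + 2 * k) ≤ (j + 2) * B ^ 2 := by
        have h4 : (j : ℝ) + 1 + k ≤ (j + 2) * (1 + k) := by nlinarith
        have h5 : (j : ℝ) + 2 * k ≤ (j + 2) * (1 + k) ^ 2 := by nlinarith [mul_nonneg hj hk.le]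
        rw [hB]
        nlinarith [mul_le_mul_of_nonneg_right h4 (by positivity : 0 ≤ 8 * (1 + k)),
          mul_nonneg (by positivity : 0 ≤ (j : ℝ) + 2) (sq_nonneg (1 + k))]
      have hBj : 0 ≤ B ^ j := by positivity
      calc _ = (2 * (j + 1 + k) * B + (j + 2 * k)) * B ^ j := by ring
        _ ≤ ((j + 2) * B ^ 2) * B ^ j := by gcongr
        _ = _ := by ring
    exact le_of_mul_le_mul_left (h1.trans h2) (by positivity)

end GegenbauerBound

/-! ### Absolute convergence and regrouping of the left-hand side -/

section DoubleSeries

/-- The general term of the series after expanding the confluent hypergeometric function. -/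
noncomputable def doubleTerm (p : ℕ) (k v φ : ℝ) (j m : ℕ) : ℝ :=
  Real.Gamma (p * j + m + p) * v ^ (p * j + m) *
    (2 * p * (j + k) / ((m.factorial : ℝ) * Real.Gamma (m + 2 * (p * j) + 2 * p * k + 1))) *
    gegenbauerC k j (Real.cos (2 * p * φ))

/-- Pochhammer symbols are absorbed into Gamma values; the numerator 2p(j+k) comes from Γ(x+1) =
xΓ(x) at x = 2p(j+k). -/
theorem hasSum_doubleTerm {k : ℝ} (hk : 0 < k) {p : ℕ} (hp : 0 < p) (v φ : ℝ) (j : ℕ) :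
    HasSum (doubleTerm p k v φ j) (seriesTerm p k v φ j) := by
  have ha : 0 < (p : ℝ) * (j + 1) := by positivity
  have hc₀ : 0 < 2 * (p : ℝ) * (j + k) := by positivity
  have hc : 0 < 2 * (p : ℝ) * (j + k) + 1 := by positivity
  have key : HasSum _ (seriesTerm p k v φ j) :=
    ((hasSum_confluentHypergeometric ha hc v).mul_left
      (Real.Gamma (p * (j + 1)) / Real.Gamma (2 * p * (j + k)) * v ^ (p * j))).mul_right
        (gegenbauerC k j (Real.cos (2 * p * φ)))
  refine key.congr_fun fun m => ?_
  have h1 := ascPochhammer_eval_mul_Gamma m ha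
  have h2 := ascPochhammer_eval_mul_Gamma m hc
  rw [Real.Gamma_add_one hc₀.ne'] at h2
  have h3 : (ascPochhammer ℝ m).eval (2 * (p : ℝ) * (j + k) + 1) ≠ 0 :=
    (ascPochhammer_pos m _ hc).ne'
  have h4 : Real.Gamma (2 * (p : ℝ) * (j + k)) ≠ 0 := (Real.Gamma_pos_of_pos hc₀).ne'
  unfold doubleTerm
  rw [show (p : ℝ) * j + m + p = p * (j + 1) + m by ring,
    show (m : ℝ) + 2 * (p * j) + 2 * p * k + 1 = 2 * p * (j + k) + 1 + m by ring, ← h1, ← h2,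
    pow_add]
  have h5 : (m.factorial : ℝ) ≠ 0 := by positivity
  have h6 : (j : ℝ) + k ≠ 0 := by positivity
  have h7 : (p : ℝ) ≠ 0 := by positivity
  generalize (ascPochhammer ℝ m).eval (2 * (p : ℝ) * (j + k) + 1) = d at *
  generalize Real.Gamma (2 * (p : ℝ) * (j + k)) = g at *
  field_simp

theorem factorial_le_ascPochhammer_eval {x : ℝ} (hx : 1 ≤ x) (n : ℕ) :
    (n.factorial : ℝ) ≤ (ascPochhammer ℝ n).eval x := by
  induction n with
  | zero => simp
  | succ n ih =>
    rw [ascPochhammer_succ_eval, Nat.factorial_succ]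
    push_cast
    rw [mul_comm]
    exact mul_le_mul ih (by linarith) (by positivity) ((Nat.cast_nonneg _).trans ih)

/-- The numerator Γ is (pj+m+p-1)!, at most a power of 2 times (p-1)! (pj+m)!, while the denominator
Γ is at least (pj+m)! j! Γ(2pk+1). Cancelling (pj+m)! leaves a product of two exponential series. -/
theorem abs_doubleTerm_le {k : ℝ} (hk : 0 < k) {p : ℕ} (hp : 0 < p) (v φ : ℝ) (j m : ℕ) :
    |doubleTerm p k v φ j m| ≤
      (2 ^ (p - 1) * ((p - 1).factorial : ℝ) * (2 * p * (1 + k)) / Real.Gamma (2 * p * k + 1)) *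
        ((2 * (4 * (1 + k)) * (2 * |v|) ^ p) ^ j / (j.factorial : ℝ) *
          ((2 * |v|) ^ m / (m.factorial : ℝ))) := by
  obtain ⟨q, rfl⟩ : ∃ q, p = q + 1 := ⟨p - 1, by omega⟩
  rw [Nat.add_sub_cancel]
  set p := q + 1 with hpdef
  have hx : 0 < 2 * (p : ℝ) * k := by positivity
  have hG0 : 0 < Real.Gamma (2 * p * k + 1) := Real.Gamma_pos_of_pos (by positivity)
  have hnum : Real.Gamma (p * j + m + p) ≤
      2 ^ (p * j + m + q) * (q.factorial : ℝ) * ((p * j + m).factorial : ℝ) := by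
    have h1 : Real.Gamma (p * j + m + p) = ((p * j + m + q).factorial : ℝ) := by
      rw [← Real.Gamma_nat_eq_factorial]
      congr 1
      push_cast [hpdef]
      ring
    rw [h1]
    have h2 := Nat.add_choose_mul_factorial_mul_factorial (p * j + m) q
    have h3 : (p * j + m + q).choose q ≤ 2 ^ (p * j + m + q) := Nat.choose_le_two_pow _ _
    have h4 : (p * j + m + q).factorial ≤
        2 ^ (p * j + m + q) * q.factorial * (p * j + m).factorial := by
      rw [← h2]
      calc _ = (p * j + m + q).choose q * (q.factorial * (p * j + m).factorial) := by ring
        _ ≤ 2 ^ (p * j + m + q) * (q.factorial * (p * j + m).factorial) := by gcongr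
        _ = _ := by ring
    exact_mod_cast h4
  have hden : ((p * j + m).factorial : ℝ) * (j.factorial : ℝ) * Real.Gamma (2 * p * k + 1) ≤
      Real.Gamma (m + 2 * (p * j) + 2 * p * k + 1) := by
    have h1 : Real.Gamma (m + 2 * (p * j) + 2 * p * k + 1) =
        (ascPochhammer ℝ (p * j + m + p * j)).eval (2 * p * k + 1) *
          Real.Gamma (2 * p * k + 1) := by
      rw [ascPochhammer_eval_mul_Gamma _ (by positivity)]
      push_cast
      ring_nf
    rw [h1]
    have h2 : (p * j + m).factorial * j.factorial ≤ (p * j + m + p * j).factorial := by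
      calc _ ≤ (p * j + m).factorial * (p * j).factorial :=
            Nat.mul_le_mul_left _ (Nat.factorial_le (Nat.le_mul_of_pos_left j hp))
        _ ≤ _ := Nat.le_of_dvd (Nat.factorial_pos _)
            (Nat.factorial_mul_factorial_dvd_factorial_add _ _)
    have h3 : (((p * j + m).factorial * j.factorial : ℕ) : ℝ) ≤
        ((p * j + m + p * j).factorial : ℝ) := by exact_mod_cast h2
    push_cast at h3
    have h4 := factorial_le_ascPochhammer_eval
      (by linarith : 1 ≤ 2 * (p : ℝ) * k + 1) (p * j + m + p * j)
    gcongr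
    exact h3.trans h4
  have hjk : (j : ℝ) + k ≤ (1 + k) * 2 ^ j := by
    have h1 : (j : ℝ) ≤ 2 ^ j := by exact_mod_cast (Nat.lt_two_pow_self (n := j)).le
    have h2 : (1 : ℝ) ≤ 2 ^ j := one_le_pow₀ (by norm_num)
    nlinarith
  have hC := abs_gegenbauerC_le hk (Real.abs_cos_le_one (2 * p * φ)) j
  have hΓ : 0 < Real.Gamma (p * j + m + p) := Real.Gamma_pos_of_pos (by positivity)
  have hΓ' : 0 < Real.Gamma (m + 2 * (p * j) + 2 * p * k + 1) :=
    Real.Gamma_pos_of_pos (by positivity)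
  unfold doubleTerm
  rw [abs_mul, abs_mul, abs_mul, abs_of_pos hΓ, abs_pow,
    abs_of_pos (by positivity : 0 < 2 * (p : ℝ) * (j + k) /
      ((m.factorial : ℝ) * Real.Gamma (m + 2 * (p * j) + 2 * p * k + 1)))]
  calc _ ≤ (2 ^ (p * j + m + q) * (q.factorial : ℝ) * ((p * j + m).factorial : ℝ)) *
        |v| ^ (p * j + m) * (2 * p * ((1 + k) * 2 ^ j) / ((m.factorial : ℝ) *
          (((p * j + m).factorial : ℝ) * (j.factorial : ℝ) * Real.Gamma (2 * p * k + 1)))) *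
        (4 * (1 + k)) ^ j := by gcongr
    _ = _ := by
      have h1 : ((p * j + m).factorial : ℝ) ≠ 0 := by positivity
      have h2 : (m.factorial : ℝ) ≠ 0 := by positivity
      have h3 : (j.factorial : ℝ) ≠ 0 := by positivity
      have h4 := hG0.ne'
      rw [pow_add |v|, pow_add 2 (p * j + m) q, pow_add 2 (p * j) m, mul_pow (2 * (4 * (1 + k))),
        mul_pow 2 (4 * (1 + k)), ← pow_mul (2 * |v|), mul_pow 2 |v|, mul_pow 2 |v|]
      field_simp

theorem summable_doubleTerm {k : ℝ} (hk : 0 < k) {p : ℕ} (hp : 0 < p) (v φ : ℝ) :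
    Summable fun z : ℕ × ℕ => doubleTerm p k v φ z.1 z.2 := by
  refine Summable.of_norm_bounded ?_ fun z => abs_doubleTerm_le hk hp v φ z.1 z.2
  refine Summable.mul_left _ ?_
  exact (Real.summable_pow_div_factorial _).mul_of_nonneg (Real.summable_pow_div_factorial _)
    (fun j => by positivity) (fun m => by positivity)

/-- Summing the double series by the total degree in `v`. -/
theorem exists_hasSum_seriesTerm {k : ℝ} (hk : 0 < k) {p : ℕ} (hp : 0 < p) (v φ : ℝ) :
    ∃ s, HasSum (seriesTerm p k v φ) s ∧
      HasSum (fun n : ℕ => Real.Gamma (n + p) * v ^ n *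
        ∑ j ∈ Finset.range (n + 1), if p * j ≤ n then
          2 * p * (j + k) / (((n - p * j).factorial : ℝ) * Real.Gamma (n + p * j + 2 * p * k + 1)) *
            gegenbauerC k j (Real.cos (2 * p * φ)) else 0) s := by
  obtain ⟨s, hs⟩ := summable_doubleTerm hk hp v φ
  refine ⟨s, hs.prod_fiberwise fun j => hasSum_doubleTerm hk hp v φ j, ?_⟩
  -- The map (j, m) ↦ (pj+m, j) is injective, so extending by zero off its range keeps the sum;
  -- summing over j first then groups by degree.
  set g : ℕ × ℕ → ℝ := fun z => if p * z.2 ≤ z.1 then doubleTerm p k v φ z.2 (z.1 - p * z.2) else 0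
    with hg
  have hinj : Function.Injective fun z : ℕ × ℕ => (p * z.1 + z.2, z.1) := by
    rintro ⟨a, b⟩ ⟨c, d⟩ h
    simp only [Prod.mk.injEq] at h
    obtain ⟨h1, rfl⟩ := h
    simpa using h1
  have hgs : HasSum g s := by
    rw [← hinj.hasSum_iff]
    · convert hs using 2 with z
      simp [hg]
    · rintro ⟨n, j⟩ hnj
      refine if_neg fun h => hnj ⟨(j, n - p * j), ?_⟩
      simp only [Prod.mk.injEq, and_true]
      exact Nat.add_sub_cancel' h
  refine hgs.prod_fiberwise fun n => ?_
  have hfin : HasSum (fun j => g (n, j)) (∑ j ∈ Finset.range (n + 1), g (n, j)) := by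
    refine hasSum_sum_of_ne_finset_zero fun j hj => if_neg ?_
    have h1 : n < j := by simpa [Nat.lt_succ_iff] using hj
    have h2 : j ≤ p * j := Nat.le_mul_of_pos_left j hp
    exact not_le.mpr (h1.trans_le h2)
  convert hfin using 1
  rw [Finset.mul_sum]
  refine Finset.sum_congr rfl fun j _ => ?_
  simp only [hg]
  split_ifs with h
  · have e : ((n - p * j : ℕ) : ℝ) = n - p * j := by push_cast [Nat.cast_sub h]; ring
    unfold doubleTerm
    rw [e, Nat.add_sub_cancel' h, show (p : ℝ) * j + (n - p * j) + p = n + p by ring,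
      show (n : ℝ) - p * j + 2 * (p * j) + 2 * p * k + 1 = n + p * j + 2 * p * k + 1 by ring]
    ring
  · rw [mul_zero]

end DoubleSeries

/-! ### The simplex formula by comparing coefficients -/

section SimplexFormula

theorem hasSum_simplexIntegral {k : ℝ} (hk : 0 < k) {p : ℕ} (hp : 0 < p) (v φ : ℝ) :
    IntegrableOn (fun x => simplexIntegrand p k v φ (simplexPoint p x)) (simplexDomain p) ∧
      HasSum (fun n : ℕ => Real.Gamma (n + p) * v ^ n *
        ∑ j ∈ Finset.range (n + 1), if p * j ≤ n then
          2 * p * (j + k) / (((n - p * j).factorial : ℝ) * Real.Gamma (n + p * j + 2 * p * k + 1)) *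
            gegenbauerC k j (Real.cos (2 * p * φ)) else 0)
        (Real.Gamma p * Real.Gamma (p * k) / (Real.Gamma k ^ p * Real.Gamma (2 * p * k)) *
          ∫ x in simplexDomain p, simplexIntegrand p k v φ (simplexPoint p x)) := by
  have hp0 : (0 : ℝ) < p := by positivity
  have hpk : 0 < (p : ℝ) * k := by positivity
  have hc : 0 < (p : ℝ) * k + 1 / 2 := by positivity
  set y : Fin p → ℝ := fun s => 4 * Real.cos (φ + ((s : ℕ) + 1 : ℝ) * Real.pi / p) ^ 2 with hy
  set S : (Fin (p - 1) → ℝ) → ℝ := fun x => v / 4 * ∑ s, simplexPoint p x s * y s with hS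
  set w : (Fin (p - 1) → ℝ) → ℝ := fun x => ∏ s, simplexPoint p x s ^ (k - 1) with hw
  have hSm : Measurable S :=
    measurable_const.mul (Finset.measurable_sum _ fun s _ =>
      ((measurable_pi_apply s).comp (measurable_simplexPoint p)).mul_const _)
  have hSb : ∀ᵐ x ∂volume.restrict (simplexDomain p), |S x| ≤ |v| := by
    refine ae_restrict_of_forall_mem (measurableSet_simplexDomain p hp) fun x hx => ?_
    have h1 : 0 ≤ ∑ s, simplexPoint p x s * y s :=
      Finset.sum_nonneg fun s _ => mul_nonneg (hx.1 s) (by positivity)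
    have h2 : ∑ s, simplexPoint p x s * y s ≤ ∑ s, simplexPoint p x s * 4 := by
      refine Finset.sum_le_sum fun s _ => mul_le_mul_of_nonneg_left ?_ (hx.1 s)
      have := Real.cos_sq_le_one (φ + ((s : ℕ) + 1 : ℝ) * Real.pi / p)
      simp only [hy]
      linarith
    rw [← Finset.sum_mul, hx.2] at h2
    rw [hS, abs_mul, abs_div, abs_of_nonneg h1, abs_of_pos (by norm_num : (0 : ℝ) < 4)]
    nlinarith [abs_nonneg v]
  have hfun : (fun x => simplexIntegrand p k v φ (simplexPoint p x)) =
      fun x => w x * confluentHypergeometric p (p * k + 1 / 2) (S x) := by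
    ext x
    simp only [simplexIntegrand, hw, hS, hy]
    congr 2
    rw [Finset.mul_sum, Finset.mul_sum]
    exact Finset.sum_congr rfl fun s _ => by ring
  have hwint : IntegrableOn w (simplexDomain p) := (dirichlet_integral hp (fun _ => k) fun _ => hk).1
  obtain ⟨h₁, h₂⟩ := integral_mul_confluentHypergeometric hp0 hc hwint hSm hSb
  rw [hfun]
  refine ⟨h₁, (h₂.mul_left _).congr_fun fun n => ?_⟩
  have hmom : ∫ x in simplexDomain p, w x * S x ^ n =
      (v / 4) ^ n * (Real.Gamma k ^ p * n.factorial / Real.Gamma (p * k + n) *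
        PowerSeries.coeff n (∏ s, negPowSeries k (y s))) := by
    rw [← dirichlet_moment hp hk, ← integral_const_mul]
    congr 1
    ext x
    simp only [hS, hw, mul_pow]
    ring
  rw [hmom, coeff_prod_negPowSeries hk hp]
  have g₁ := ascPochhammer_eval_mul_Gamma n hp0
  have g₂ := ascPochhammer_eval_mul_Gamma n hpk
  -- Duplication gives (2pk)_{2n} = 4ⁿ (pk)_n (pk+1/2)_n. This absorbs the parameter pk + 1/2 of ₁F₁
  -- and the 4ⁿ introduced by the factor 4 in y.
  have g₃ := ascPochhammer_eval_mul_Gamma (2 * n) (by positivity : 0 < 2 * ((p : ℝ) * k))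
  rw [ascPochhammer_eval_two_mul] at g₃
  rw [show 2 * (n : ℝ) + 2 * p * k = 2 * (p * k) + (2 * n : ℕ) by push_cast; ring, ← g₃, ← g₂,
    add_comm (n : ℝ) (p : ℝ), ← g₁, show 2 * (p : ℝ) * k = 2 * (p * k) by ring, div_pow]
  have n₁ : Real.Gamma k ≠ 0 := (Real.Gamma_pos_of_pos hk).ne'
  have n₂ : Real.Gamma (p * k) ≠ 0 := (Real.Gamma_pos_of_pos hpk).ne'
  have n₃ : Real.Gamma (2 * (p * k)) ≠ 0 := (Real.Gamma_pos_of_pos (by positivity)).ne'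
  have n₄ : (ascPochhammer ℝ n).eval (p * k) ≠ 0 := (ascPochhammer_pos n _ hpk).ne'
  have n₅ : (ascPochhammer ℝ n).eval (p * k + 1 / 2) ≠ 0 := (ascPochhammer_pos n _ hc).ne'
  have n₆ : (n.factorial : ℝ) ≠ 0 := by positivity
  generalize (ascPochhammer ℝ n).eval (p * k + 1 / 2) = c₁ at *
  generalize Real.Gamma (2 * (p * k)) = c₂ at *
  generalize (ascPochhammer ℝ n).eval (p * k) = c₃ at *
  generalize Real.Gamma (p * k) = c₄ at *
  field_simp

theorem hasSum_seriesTerm_simplex {k : ℝ} (hk : 0 < k) {p : ℕ} (hp : 0 < p) (v φ : ℝ) :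
    HasSum (seriesTerm p k v φ)
      (Real.Gamma p * Real.Gamma (p * k) / (Real.Gamma k ^ p * Real.Gamma (2 * p * k)) *
        ∫ x in simplexDomain p, simplexIntegrand p k v φ (simplexPoint p x)) := by
  obtain ⟨s, hs₁, hs₂⟩ := exists_hasSum_seriesTerm hk hp v φ
  rwa [← hs₂.unique (hasSum_simplexIntegral hk hp v φ).2]

end SimplexFormula

/-! ### The case p = 2 as an integral against the symmetric Beta law -/

section BetaFormula

/-- With u₁ = (1+t)/2 and u₂ = (1-t)/2, u₁u₂ = (1-t²)/4; the angles φ + π/2 and φ + π contribute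
sin²φ and cos²φ. -/
theorem simplexIntegrand_two_eq {k : ℝ} (v φ t : ℝ) (ht : t ∈ Set.Icc (-1 : ℝ) 1) :
    simplexIntegrand 2 k v φ (simplexPoint 2 fun _ => (1 + t) / 2) =
      (1 / 4) ^ (k - 1) * ((1 - t ^ 2) ^ (k - 1) *
        confluentHypergeometric 2 (2 * k + 1 / 2) (v * (1 - Real.cos (2 * φ) * t) / 2)) := by
  have e₁ : simplexPoint 2 (fun _ => (1 + t) / 2) 0 = (1 + t) / 2 := by simp [simplexPoint]
  have e₂ : simplexPoint 2 (fun _ => (1 + t) / 2) 1 = (1 - t) / 2 := by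
    simp [simplexPoint]
    ring
  have c₁ : Real.cos (φ + Real.pi / 2) ^ 2 = (1 - Real.cos (2 * φ)) / 2 := by
    rw [Real.cos_add_pi_div_two, neg_sq, Real.sin_sq, Real.cos_sq]
    ring
  have c₂ : Real.cos (φ + Real.pi) ^ 2 = (1 + Real.cos (2 * φ)) / 2 := by
    rw [Real.cos_add_pi, neg_sq, Real.cos_sq]
    ring
  unfold simplexIntegrand
  rw [Fin.prod_univ_two, Fin.sum_univ_two, e₁, e₂, ← mul_assoc,
    ← Real.mul_rpow (by linarith [ht.1]) (by linarith [ht.2]),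
    ← Real.mul_rpow (by norm_num) (by nlinarith [ht.1, ht.2])]
  congr 2
  · ring
  · have a₁ : φ + (((0 : Fin 2) : ℕ) + 1 : ℝ) * Real.pi / (2 : ℕ) = φ + Real.pi / 2 := by simp
    have a₂ : φ + (((1 : Fin 2) : ℕ) + 1 : ℝ) * Real.pi / (2 : ℕ) = φ + Real.pi := by
      simp; ring
    rw [a₁, a₂, c₁, c₂]
    ring

theorem integral_simplexDomain_two {G : (Fin (2 - 1) → ℝ) → ℝ}
    (hG : IntegrableOn G (simplexDomain 2)) :
    IntegrableOn (fun t : ℝ => G fun _ => (1 + t) / 2) (Set.Icc (-1) 1) ∧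
      ∫ x in simplexDomain 2, G x =
        1 / 2 * ∫ t in Set.Icc (-1 : ℝ) 1, G fun _ => (1 + t) / 2 := by
  set H : ℝ → ℝ := (Set.Icc (0 : ℝ) 1).indicator fun u => G fun _ => u with hH
  have hmp := (volume_preserving_funUnique (Fin 1) ℝ).symm
  have hemb := (MeasurableEquiv.funUnique (Fin 1) ℝ).symm.measurableEmbedding
  have hD := measurableSet_simplexDomain 2 two_pos
  have hcomp : (simplexDomain 2).indicator G ∘ (MeasurableEquiv.funUnique (Fin 1) ℝ).symm = H := by
    ext u
    have hu : (MeasurableEquiv.funUnique (Fin 1) ℝ).symm u = fun _ => u := rfl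
    rw [Function.comp_apply, hu]
    have hmem : ((fun _ => u : Fin 1 → ℝ) ∈ simplexDomain 2) ↔ u ∈ Set.Icc (0 : ℝ) 1 := by
      rw [simplexDomain_succ 1]
      simp
    by_cases h : u ∈ Set.Icc (0 : ℝ) 1
    · rw [hH, Set.indicator_of_mem h, Set.indicator_of_mem (hmem.mpr h)]
    · rw [hH, Set.indicator_of_notMem h, Set.indicator_of_notMem (mt hmem.mp h)]
  have hHint : Integrable H := by
    rw [← hcomp]
    exact (hmp.integrable_comp_emb hemb).mpr ((integrable_indicator_iff hD).mpr hG)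
  have hHval : ∫ u, H u = ∫ x in simplexDomain 2, G x := by
    rw [← integral_indicator hD, ← hcomp]
    exact hmp.integral_comp hemb ((simplexDomain 2).indicator G)
  have hshift : (fun t : ℝ => H (1 / 2 * (1 + t))) =
      (Set.Icc (-1 : ℝ) 1).indicator fun t => G fun _ => (1 + t) / 2 := by
    ext t
    by_cases h : t ∈ Set.Icc (-1 : ℝ) 1
    · rw [hH, Set.indicator_of_mem h, Set.indicator_of_mem
        (show 1 / 2 * (1 + t) ∈ Set.Icc (0 : ℝ) 1 from
          ⟨by linarith [h.1], by linarith [h.2]⟩)]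
      congr 1
      ext
      ring
    · rw [hH, Set.indicator_of_notMem h, Set.indicator_of_notMem]
      exact fun h' => h ⟨by linarith [h'.1], by linarith [h'.2]⟩
  constructor
  · rw [← integrable_indicator_iff measurableSet_Icc, ← hshift]
    exact (hHint.comp_mul_left' (by norm_num : (1 / 2 : ℝ) ≠ 0)).comp_add_left 1
  · rw [← integral_indicator measurableSet_Icc, ← hshift, ← hHval,
      integral_add_left_eq_self (fun t : ℝ => H (1 / 2 * t)) 1, Measure.integral_comp_mul_left]
    norm_num
    ring

theorem symmetricBeta_integral {k : ℝ} (hk : 0 < k) {F : ℝ → ℝ}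
    (hF : IntegrableOn (fun t => (1 - t ^ 2) ^ (k - 1) * F t) (Set.Icc (-1) 1)) :
    Integrable F (symmetricBeta k) ∧ ∫ u, F u ∂(symmetricBeta k) =
      Real.Gamma (k + 1 / 2) / (Real.sqrt Real.pi * Real.Gamma k) *
        ∫ t in Set.Icc (-1 : ℝ) 1, (1 - t ^ 2) ^ (k - 1) * F t := by
  set c := Real.Gamma (k + 1 / 2) / (Real.sqrt Real.pi * Real.Gamma k) with hc
  have hc0 : 0 ≤ c := by
    have := Real.Gamma_pos_of_pos hk
    have := Real.Gamma_pos_of_pos (by positivity : 0 < k + 1 / 2)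
    positivity
  have hm : Measurable fun u : ℝ => ENNReal.ofReal (c * (1 - u ^ 2) ^ (k - 1)) := by fun_prop
  have hlt : ∀ᵐ u ∂volume.restrict (Set.Icc (-1 : ℝ) 1),
      ENNReal.ofReal (c * (1 - u ^ 2) ^ (k - 1)) < ⊤ := .of_forall fun u => ENNReal.ofReal_lt_top
  have heq : Set.EqOn (fun u : ℝ => (ENNReal.ofReal (c * (1 - u ^ 2) ^ (k - 1))).toReal • F u)
      (fun u => c * ((1 - u ^ 2) ^ (k - 1) * F u)) (Set.Icc (-1 : ℝ) 1) := by
    intro u hu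
    have h1 : 0 ≤ 1 - u ^ 2 := by nlinarith [hu.1, hu.2]
    dsimp only
    rw [ENNReal.toReal_ofReal (by positivity), smul_eq_mul, mul_assoc]
  rw [symmetricBeta, ← hc]
  constructor
  · rw [integrable_withDensity_iff_integrable_smul' hm hlt]
    exact IntegrableOn.congr_fun (hF.const_mul c) heq.symm measurableSet_Icc
  · rw [integral_withDensity_eq_integral_toReal_smul hm hlt,
      setIntegral_congr_fun measurableSet_Icc heq, integral_const_mul]

theorem hasSum_seriesTerm_symmetricBeta {k : ℝ} (hk : 0 < k) (v φ : ℝ) :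
    Integrable (fun u : ℝ => confluentHypergeometric 2 (2 * k + 1 / 2)
        (v * (1 - Real.cos (2 * φ) * u) / 2)) (symmetricBeta k) ∧
      HasSum (seriesTerm 2 k v φ)
        (1 / Real.Gamma (4 * k) *
          ∫ u, confluentHypergeometric 2 (2 * k + 1 / 2)
            (v * (1 - Real.cos (2 * φ) * u) / 2) ∂(symmetricBeta k)) := by
  obtain ⟨h₁, h₂⟩ := integral_simplexDomain_two (hasSum_simplexIntegral hk two_pos v φ).1
  have heq : Set.EqOn (fun t : ℝ => simplexIntegrand 2 k v φ (simplexPoint 2 fun _ => (1 + t) / 2))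
      (fun t => (1 / 4) ^ (k - 1) * ((1 - t ^ 2) ^ (k - 1) *
        confluentHypergeometric 2 (2 * k + 1 / 2) (v * (1 - Real.cos (2 * φ) * t) / 2)))
      (Set.Icc (-1 : ℝ) 1) := fun t ht => simplexIntegrand_two_eq v φ t ht
  have h4 : (0 : ℝ) < (1 / 4) ^ (k - 1) := by positivity
  have hint := h₁.congr_fun heq measurableSet_Icc
  have hint' := (hint.const_mul ((1 / 4 : ℝ) ^ (k - 1))⁻¹)
  simp_rw [inv_mul_cancel_left₀ h4.ne'] at hint'
  obtain ⟨h₃, h₅⟩ := symmetricBeta_integral hk hint'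
  refine ⟨h₃, ?_⟩
  have h := hasSum_seriesTerm_simplex hk two_pos v φ
  rw [h₂, setIntegral_congr_fun measurableSet_Icc heq, integral_const_mul] at h
  rw [h₅]
  convert h using 1
  -- The constants agree by Legendre duplication: the Jacobian 1/2 times 4^(1-k) equals 2^(1-2k).
  have hdup := Real.Gamma_mul_Gamma_add_half k
  have hpow : (1 / 4 : ℝ) ^ (k - 1) = 2 * 2 ^ (1 - 2 * k) := by
    rw [show (1 / 4 : ℝ) = 2 ^ (-2 : ℝ) by
      rw [Real.rpow_neg (by norm_num)]; norm_num, ← Real.rpow_mul (by norm_num)]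
    rw [show (-2 : ℝ) * (k - 1) = (1 - 2 * k) + 1 by ring, Real.rpow_add_one (by norm_num)]
    ring
  have n₁ : Real.Gamma k ≠ 0 := (Real.Gamma_pos_of_pos hk).ne'
  have n₂ : Real.Gamma (4 * k) ≠ 0 := (Real.Gamma_pos_of_pos (by positivity)).ne'
  have n₃ : Real.sqrt Real.pi ≠ 0 := (Real.sqrt_pos.mpr Real.pi_pos).ne'
  push_cast
  rw [hpow, Real.Gamma_two, show (2 : ℝ) * 2 * k = 4 * k by norm_num]
  generalize (∫ t in Set.Icc (-1 : ℝ) 1, (1 - t ^ 2) ^ (k - 1) * confluentHypergeometric 2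
    (2 * k + 1 / 2) (v * (1 - Real.cos (2 * φ) * t) / 2)) = J
  generalize (2 : ℝ) ^ (1 - 2 * k) = a at *
  generalize Real.Gamma (k + 1 / 2) = b at *
  have hb : b = Real.Gamma (2 * k) * a * Real.sqrt Real.pi / Real.Gamma k := by
    rw [eq_div_iff n₁, mul_comm, hdup]
  rw [hb]
  field_simp

end BetaFormula

theorem mainTheorem2 (k : ℝ) (hk : 0 < k) :
    (∀ p : ℕ, 2 ≤ p → ∀ v φ : ℝ,
      IntegrableOn (fun x => simplexIntegrand p k v φ (simplexPoint p x)) (simplexDomain p) ∧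
      HasSum (seriesTerm p k v φ)
        (Real.Gamma p * Real.Gamma (p * k) / (Real.Gamma k ^ p * Real.Gamma (2 * p * k)) *
          ∫ x in simplexDomain p, simplexIntegrand p k v φ (simplexPoint p x))) ∧
    (∀ v φ : ℝ,
      Integrable (fun u : ℝ => confluentHypergeometric 2 (2 * k + 1 / 2)
        (v * (1 - Real.cos (2 * φ) * u) / 2)) (symmetricBeta k) ∧
      HasSum (seriesTerm 2 k v φ)
        (1 / Real.Gamma (4 * k) *
          ∫ u, confluentHypergeometric 2 (2 * k + 1 / 2)
            (v * (1 - Real.cos (2 * φ) * u) / 2) ∂(symmetricBeta k))) := by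
  exact ⟨fun p hp v φ => ⟨(hasSum_simplexIntegral hk (by omega) v φ).1,
    hasSum_seriesTerm_simplex hk (by omega) v φ⟩,
    fun v φ => hasSum_seriesTerm_symmetricBeta hk v φ⟩
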